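/- Let $Q$ be a finite-dimensional smooth manifold with a nonholonomic system: a lagrangian $L(v)=\tfrac12\kappa(v,v)-U(q)$ of mechanical type (with $\kappa$ a smooth riemannian metric) and a smooth distribution $D\subseteq TQ$ of constant rank. Let $\mathcal M=\kappa^\flat(D)\subseteq T^*Q$ be the constraint submanifold, $\iota:\mathcal M\to T^*Q$ the inclusion, $\tau:\mathcal M\to Q$ the projection, $\Theta_{\mathcal M}=\iota^*\Theta_Q$ and $\Omega_{\mathcal M}=\iota^*\Omega_Q$ the pullbacks of the canonical forms of $T^*Q$ (with $\Omega_Q=-d\Theta_Q$), and $\mathcal C_m=\{v\in T_m\mathcal M: T\tau(v)\in D_{\tau(m)}\}$. For a 1-form $\alpha$ on $\mathcal M$, define $\pi_{nh}^\sharp(\alpha)=-X$, where $X$ is the unique section of $\mathcal C$ with $\mathbf i_X\Omega_{\mathcal M}|_{\mathcal C}=\alpha|_{\mathcal C}$. Let $G$ be a Lie group with Lie algebra $\mathfrak g$, acting smoothly and properly on $Q$ so that the tangent lift of the action preserves $L$ and $D$; $G$ then acts on $\mathcal M$ by the cotangent lift. Write $\eta_Q,\eta_{\mathcal M}$ for the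 infinitesimal generators of $\eta\in\mathfrak g$ on $Q$ and $\mathcal M$, $V_q=\{\eta_Q(q):\eta\in\mathfrak g\}$, and $\mathfrak g_S=\{(\xi,q)\in\mathfrak g\times Q:\xi_Q(q)\in D_q\cap V_q\}$. For a section $\xi$ of $\mathfrak g_S$ put $\xi_{\mathcal M}(m)=(\xi_{\tau(m)})_{\mathcal M}(m)$, and let $J^{nh}(m)\in(\mathfrak g_S)^*_{\tau(m)}$ be given by $\langle J^{nh},\xi\rangle=\mathbf i_{\xi_{\mathcal M}}\Theta_{\mathcal M}$. Let $W$ be a vertical complement of the constraints ($TQ=D\oplus W$, $W\subseteq V$) satisfying the vertical-symmetry condition: there is an $\mathrm{Ad}$-invariant subspace $\mathfrak w\subseteq\mathfrak g$ such that $(\eta,q)\mapsto\eta_Q(q)$ restricts to an isomorphism $\mathfrak w\times Q\cong W$. Then $\mathfrak g\times Q=\mathfrak g_S\oplus(\mathfrak w\times Q)$; let $P_{\mathfrak g_S}$ be the corresponding projection onto $\mathfrak g_S$. Also $T\mathcal M=\mathcal C\oplus\mathcal W$ with $\mathcal W_m=\mathrm{span}\{\eta_{\mathcal M}(m):\eta\in\mathfrak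 w\}$; let $P_{\mathcal C},P_{\mathcal W}$ be the projections, let $\mathcal A_{\mathcal W}:T\mathcal M\to\mathfrak g$ be the 1-form with $\mathcal A_{\mathcal W}(v_m)=\xi\in\mathfrak w$ if and only if $P_{\mathcal W}(v_m)=\xi_{\mathcal M}(m)$, and let $\mathcal K_{\mathcal W}(X,Y)=d\mathcal A_{\mathcal W}(P_{\mathcal C}X,P_{\mathcal C}Y)$. Let $\mathcal J=\iota^*J_Q:\mathcal M\to\mathfrak g^*$ be the restriction of the canonical momentum map $\langle J_Q(\alpha_q),\eta\rangle=\alpha_q(\eta_Q(q))$, and let $\langle\mathcal J,\mathcal K_{\mathcal W}\rangle$ be the 2-form on $\mathcal M$ obtained by pairing. Let $\{\eta_1,\dots,\eta_N\}$ be a basis of $\mathfrak g$ such that $\{\eta_{k+1},\dots,\eta_N\}$ is a basis of $\mathfrak w$, and for $i=1,\dots,k$ set $\xi_i=P_{\mathfrak g_S}(\eta_i)$ and $j_i=\langle J^{nh},\xi_i\rangle$. For $f_1,\dots,f_k\in C^\infty(Q)$ (regarded also as functions on $\mathcal M$ through $\tau$), let $J=\sum_i f_i\,j_i$ and $\chi=\sum_i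 f_i\,\xi_i$. Then all these objects are well defined (each 1-form on $\mathcal C$ equals $\mathbf i_X\Omega_{\mathcal M}|_{\mathcal C}$ for a unique $X$ in $\mathcal C$, $T\mathcal M=\mathcal C\oplus\mathcal W$, and $\eta\mapsto\eta_{\mathcal M}(m)$ is injective on $\mathfrak w$), $J\in C^\infty(\mathcal M)$, $\chi$ is a smooth section of $\mathfrak g_S$, and $$\pi_{nh}^\sharp(\Lambda-dJ)=\chi_{\mathcal M},\qquad\text{where}\qquad \Lambda=\sum_{i=1}^k\bigl(j_i\,df_i+f_i\,\mathbf i_{(\xi_i)_{\mathcal M}}\langle\mathcal J,\mathcal K_{\mathcal W}\rangle\bigr).$$ -/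

import Mathlib

set_option linter.unusedSectionVars false

open scoped Manifold ContDiff Bundle Topology
open Bundle

namespace Nonholonomic

section Forms

variable {E' : Type*} [NormedAddCommGroup E'] [NormedSpace ℝ E'] [FiniteDimensional ℝ E']
  {H : Type*} [TopologicalSpace H] (I : ModelWithCorners ℝ E' H)
  {N : Type*} [TopologicalSpace N] [ChartedSpace H N]
  {F : Type*} [NormedAddCommGroup F] [NormedSpace ℝ F]

/-- The representative, in the preferred chart at `x₀`, of a 1-form `α` on a manifold `N` with
values in the vector space `F`: the pullback of `α` by the inverse of the chart. -/
noncomputable def chartForm (α : ∀ x : N, TangentSpace I x →ₗ[ℝ] F) (x₀ : N) (y : E') :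
    E' →L[ℝ] F :=
  LinearMap.toContinuousLinearMap
    ((α ((extChartAt I x₀).symm y)).comp
      (mfderiv 𝓘(ℝ, E') I (extChartAt I x₀).symm y :
        E' →L[ℝ] TangentSpace I ((extChartAt I x₀).symm y)).toLinearMap)

/-- The exterior derivative `dα` of an `F`-valued 1-form on a manifold without boundary, computed in
the preferred chart at each point `x`: `dα (u, v) = D_u α (v) - D_v α (u)`, i.e. the convention
`dα (X, Y) = X (α Y) - Y (α X) - α [X, Y]`. -/
noncomputable def extDerivForm (α : ∀ x : N, TangentSpace I x →ₗ[ℝ] F) (x : N) :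
    TangentSpace I x →ₗ[ℝ] TangentSpace I x →ₗ[ℝ] F :=
  let A : E' →ₗ[ℝ] E' →ₗ[ℝ] F :=
    (ContinuousLinearMap.coeLM ℝ).comp
      (fderiv ℝ (chartForm I α x) (extChartAt I x x)).toLinearMap
  let T : TangentSpace I x →ₗ[ℝ] E' :=
    (mfderiv I 𝓘(ℝ, E') (extChartAt I x) x : TangentSpace I x →L[ℝ] E').toLinearMap
  (A - A.flip).compl₁₂ T T

/-- The differential `df` of a real function on a manifold. -/
noncomputable def differential (f : N → ℝ) (x : N) : TangentSpace I x →ₗ[ℝ] ℝ :=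
  (mfderiv I 𝓘(ℝ, ℝ) f x : TangentSpace I x →L[ℝ] ℝ).toLinearMap

end Forms

variable (E : Type*) [NormedAddCommGroup E] [NormedSpace ℝ E] [FiniteDimensional ℝ E]
  (Q : Type*) [TopologicalSpace Q] [ChartedSpace E Q] [IsManifold 𝓘(ℝ, E) ∞ Q]

/-- The cotangent bundle `T*Q` of a manifold `Q` modelled on `E`. -/
abbrev CotangentBundle : Type _ :=
  TotalSpace (E →L[ℝ] ℝ) (fun q : Q => TangentSpace 𝓘(ℝ, E) q →L[ℝ] ℝ)

/-- A nonholonomic system on `Q`: a lagrangian of mechanical type, given by a kinetic energy metric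
and a potential, and a smooth constraint distribution `D ⊆ TQ` of constant rank `r`
(i.e. spanned, near each point, by `r` pointwise linearly independent smooth vector fields). -/
structure NHSystem (r : ℕ) where
  /-- the kinetic energy metric `κ` -/
  kinetic : ContMDiffRiemannianMetric 𝓘(ℝ, E) ∞ E (fun q : Q => TangentSpace 𝓘(ℝ, E) q)
  /-- the potential energy -/
  potential : Q → ℝ
  contMDiff_potential : ContMDiff 𝓘(ℝ, E) 𝓘(ℝ, ℝ) ∞ potential
  /-- the constraint distribution -/
  D : ∀ q : Q, Submodule ℝ (TangentSpace 𝓘(ℝ, E) q)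
  exists_frame : ∀ q₀ : Q, ∃ U : Set Q, IsOpen U ∧ q₀ ∈ U ∧
    ∃ X : Fin r → ∀ q : Q, TangentSpace 𝓘(ℝ, E) q,
      (∀ a, ContMDiffOn 𝓘(ℝ, E) (𝓘(ℝ, E).prod 𝓘(ℝ, E)) ∞
        (fun q => (⟨q, X a q⟩ : TangentBundle 𝓘(ℝ, E) Q)) U) ∧
      ∀ q ∈ U, LinearIndependent ℝ (fun a => X a q) ∧
        Submodule.span ℝ (Set.range fun a => X a q) = D q

variable {E Q}

namespace NHSystem

variable {r : ℕ} (S : NHSystem E Q r)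

/-- The lagrangian `L (v) = κ (v, v) / 2 - U (q)` for `v ∈ T_q Q`. -/
noncomputable def lagrangian (v : TangentBundle 𝓘(ℝ, E) Q) : ℝ :=
  S.kinetic.inner v.1 v.2 v.2 / 2 - S.potential v.1

/-- The constraint submanifold `M = κ♭(D) ⊆ T*Q`, as a set. -/
def constraintSet : Set (CotangentBundle E Q) :=
  {p | ∃ v ∈ S.D p.1, p.2 = S.kinetic.inner p.1 v}

/-- The constraint submanifold `M = κ♭(D) ⊆ T*Q`, with the subspace topology. -/
abbrev M : Type _ := S.constraintSet

/-- The inclusion `ι : M → T*Q`. -/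
def incl (m : S.M) : CotangentBundle E Q := m.1

/-- The projection `τ : M → Q`. -/
def τ (m : S.M) : Q := m.1.1

/-! ### The smooth structure of `M`

Over the domain of a chart `φ` of `Q` and of a local frame `X₁, …, X_r` of `D`, the coordinates of a
point `(q, p)` of `M` are `φ q` and the quasi-momenta `p (X_a q)`. -/

/-- The domain of the frame of `D` that is used near `q₀`. -/
noncomputable def frameSet (q₀ : Q) : Set Q := (S.exists_frame q₀).choose

/-- The frame of `D` that is used near `q₀`. -/
noncomputable def frame (q₀ : Q) : Fin r → ∀ q : Q, TangentSpace 𝓘(ℝ, E) q :=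
  (S.exists_frame q₀).choose_spec.2.2.choose

theorem isOpen_frameSet (q₀ : Q) : IsOpen (S.frameSet q₀) :=
  (S.exists_frame q₀).choose_spec.1

theorem mem_frameSet (q₀ : Q) : q₀ ∈ S.frameSet q₀ :=
  (S.exists_frame q₀).choose_spec.2.1

theorem contMDiffOn_frame (q₀ : Q) (a : Fin r) :
    ContMDiffOn 𝓘(ℝ, E) (𝓘(ℝ, E).prod 𝓘(ℝ, E)) ∞
      (fun q => (⟨q, S.frame q₀ a q⟩ : TangentBundle 𝓘(ℝ, E) Q)) (S.frameSet q₀) :=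
  (S.exists_frame q₀).choose_spec.2.2.choose_spec.1 a

theorem linearIndependent_frame (q₀ : Q) {q : Q} (hq : q ∈ S.frameSet q₀) :
    LinearIndependent ℝ (fun a => S.frame q₀ a q) :=
  ((S.exists_frame q₀).choose_spec.2.2.choose_spec.2 q hq).1

theorem span_frame (q₀ : Q) {q : Q} (hq : q ∈ S.frameSet q₀) :
    Submodule.span ℝ (Set.range fun a => S.frame q₀ a q) = S.D q :=
  ((S.exists_frame q₀).choose_spec.2.2.choose_spec.2 q hq).2

/-- The Gram matrix of the frame, as a linear map of `ℝ^r`. -/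
noncomputable def gram (q₀ q : Q) : (Fin r → ℝ) →L[ℝ] (Fin r → ℝ) :=
  ∑ a, ∑ b, S.kinetic.inner q (S.frame q₀ a q) (S.frame q₀ b q) •
    (ContinuousLinearMap.proj b : (Fin r → ℝ) →L[ℝ] ℝ).smulRight (Pi.single a (1 : ℝ) : Fin r → ℝ)

theorem gram_apply (q₀ q : Q) (w : Fin r → ℝ) (a : Fin r) :
    S.gram q₀ q w a =
      S.kinetic.inner q (∑ b, w b • S.frame q₀ b q) (S.frame q₀ a q) := by
  have h : S.gram q₀ q w a
      = ∑ b, S.kinetic.inner q (S.frame q₀ a q) (S.frame q₀ b q) * w b := by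
    simp [gram, Finset.sum_apply, Pi.single_apply]
  rw [h, S.kinetic.symm, map_sum]
  simp [mul_comm]

theorem exists_gram_equiv (q₀ : Q) {q : Q} (hq : q ∈ S.frameSet q₀) :
    ∃ e : (Fin r → ℝ) ≃L[ℝ] (Fin r → ℝ), (e : (Fin r → ℝ) →L[ℝ] (Fin r → ℝ)) = S.gram q₀ q := by
  have inj : Function.Injective (S.gram q₀ q).toLinearMap := by
    rw [← LinearMap.ker_eq_bot, LinearMap.ker_eq_bot']
    intro w hw
    have hw' : S.gram q₀ q w = 0 := hw
    set v : TangentSpace 𝓘(ℝ, E) q := ∑ b, w b • S.frame q₀ b q with hv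
    have hz : S.kinetic.inner q v v = 0 := by
      have h : S.kinetic.inner q v (∑ a, w a • S.frame q₀ a q) = 0 := by
        rw [map_sum]
        refine Finset.sum_eq_zero fun a _ => ?_
        rw [map_smul, hv, ← gram_apply, hw']
        simp
      exact h
    have hv0 : v = 0 := by
      by_contra hne
      exact (S.kinetic.pos q v hne).ne' hz
    funext a
    exact Fintype.linearIndependent_iff.1 (S.linearIndependent_frame q₀ hq) w hv0 a
  exact ⟨(LinearEquiv.ofInjectiveEndo _ inj).toContinuousLinearEquiv, by ext; rfl⟩

/-- The coordinates on `M` near the fibre over `q₀`, as a map defined on `T*Q`. -/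
noncomputable def toCoord (q₀ : Q) (p : CotangentBundle E Q) : E × (Fin r → ℝ) :=
  (chartAt E q₀ p.1, fun a => p.2 (S.frame q₀ a p.1))

/-- The domain of the coordinates on `M` near the fibre over `q₀`. -/
def coordBase (q₀ : Q) : Set Q := (chartAt E q₀).source ∩ S.frameSet q₀

/-- The inverse of the coordinates on `M`, as a map with values in `T*Q`. -/
noncomputable def ofCoord (q₀ : Q) (y : E × (Fin r → ℝ)) : CotangentBundle E Q :=
  ⟨(chartAt E q₀).symm y.1, S.kinetic.inner _
    (∑ a, (S.gram q₀ ((chartAt E q₀).symm y.1)).inverse y.2 a •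
      S.frame q₀ a ((chartAt E q₀).symm y.1))⟩

/-- `(q, p) ∈ M` and `p = κ (v, ·)` for the vector `v ∈ D_q` with the given quasi-momenta. -/
theorem eq_of_coord (q₀ : Q) {p : CotangentBundle E Q} (hp : p ∈ S.constraintSet)
    (hq : p.1 ∈ S.frameSet q₀) :
    p.2 = S.kinetic.inner _
      (∑ a, (S.gram q₀ p.1).inverse (fun a => p.2 (S.frame q₀ a p.1)) a • S.frame q₀ a p.1) := by
  obtain ⟨v, hv, hpv⟩ := hp
  rw [← S.span_frame q₀ hq, Submodule.mem_span_range_iff_exists_fun] at hv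
  obtain ⟨w, rfl⟩ := hv
  obtain ⟨e, he⟩ := S.exists_gram_equiv q₀ hq
  have h : (fun a => p.2 (S.frame q₀ a p.1)) = e w := by
    funext a
    rw [hpv, ← gram_apply, ← he]
    rfl
  rw [h, ← he, ContinuousLinearMap.inverse_equiv]
  simpa using hpv

theorem toCoord_ofCoord (q₀ : Q) {y : E × (Fin r → ℝ)} (hy : y.1 ∈ (chartAt E q₀).target)
    (hq : (chartAt E q₀).symm y.1 ∈ S.frameSet q₀) :
    S.toCoord q₀ (S.ofCoord q₀ y) = y := by
  obtain ⟨e, he⟩ := S.exists_gram_equiv q₀ hq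
  refine Prod.ext ((chartAt E q₀).right_inv hy) ?_
  funext a
  refine (S.gram_apply q₀ _ _ a).symm.trans ?_
  rw [← he, ContinuousLinearMap.inverse_equiv]
  simp

theorem ofCoord_mem (q₀ : Q) {y : E × (Fin r → ℝ)}
    (hq : (chartAt E q₀).symm y.1 ∈ S.frameSet q₀) :
    S.ofCoord q₀ y ∈ S.constraintSet := by
  refine ⟨_, ?_, rfl⟩
  change _ ∈ S.D ((chartAt E q₀).symm y.1)
  rw [← S.span_frame q₀ hq, Submodule.mem_span_range_iff_exists_fun]
  exact ⟨_, rfl⟩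

theorem ofCoord_toCoord (q₀ : Q) {p : CotangentBundle E Q} (hp : p ∈ S.constraintSet)
    (hq : p.1 ∈ S.coordBase q₀) : S.ofCoord q₀ (S.toCoord q₀ p) = p := by
  obtain ⟨q, p⟩ := p
  have h1 : (chartAt E q₀).symm (chartAt E q₀ q) = q := (chartAt E q₀).left_inv hq.1
  have h2 := S.eq_of_coord q₀ hp hq.2
  simp only at h2 hq
  unfold ofCoord toCoord
  simp only
  rw [h1]
  conv_rhs => rw [h2]

theorem contMDiffOn_toCoord (q₀ : Q) :
    ContMDiffOn (𝓘(ℝ, E).prod 𝓘(ℝ, E →L[ℝ] ℝ)) 𝓘(ℝ, E × (Fin r → ℝ)) ∞ (S.toCoord q₀)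
      {p | p.1 ∈ S.coordBase q₀} := by
  have hπ : ContMDiff (𝓘(ℝ, E).prod 𝓘(ℝ, E →L[ℝ] ℝ)) 𝓘(ℝ, E) ∞
      (fun p : CotangentBundle E Q => p.1) := Bundle.contMDiff_proj _
  have h1 : ContMDiffOn (𝓘(ℝ, E).prod 𝓘(ℝ, E →L[ℝ] ℝ)) 𝓘(ℝ, E) ∞
      (fun p : CotangentBundle E Q => chartAt E q₀ p.1) {p | p.1 ∈ S.coordBase q₀} :=
    (contMDiffOn_chart (I := 𝓘(ℝ, E)) (x := q₀)).comp hπ.contMDiffOn fun p hp => hp.1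
  have h2 : ∀ a, ContMDiffOn (𝓘(ℝ, E).prod 𝓘(ℝ, E →L[ℝ] ℝ)) 𝓘(ℝ, ℝ) ∞
      (fun p : CotangentBundle E Q => p.2 (S.frame q₀ a p.1)) {p | p.1 ∈ S.coordBase q₀} := by
    intro a
    have hX := (S.contMDiffOn_frame q₀ a).comp (t := S.frameSet q₀) hπ.contMDiffOn
      (s := {p | p.1 ∈ S.coordBase q₀}) fun p hp => hp.2
    have hid : ContMDiffOn (𝓘(ℝ, E).prod 𝓘(ℝ, E →L[ℝ] ℝ)) (𝓘(ℝ, E).prod 𝓘(ℝ, E →L[ℝ] ℝ)) ∞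
      (fun p : CotangentBundle E Q => TotalSpace.mk' (E →L[ℝ] ℝ)
        (E := fun q : Q => TangentSpace 𝓘(ℝ, E) q →L[ℝ] Bundle.Trivial Q ℝ q) p.1 p.2)
        {p | p.1 ∈ S.coordBase q₀} := contMDiffOn_id
    have h := ContMDiffOn.clm_bundle_apply (E₂ := Bundle.Trivial Q ℝ) hid hX
    intro p hp
    exact (contMDiffWithinAt_totalSpace.1 (h p hp)).2
  exact h1.prodMk_space (contMDiffOn_pi_space.2 h2)

theorem contMDiffOn_gram (q₀ : Q) :
    ContMDiffOn 𝓘(ℝ, E) 𝓘(ℝ, (Fin r → ℝ) →L[ℝ] (Fin r → ℝ)) ∞ (S.gram q₀) (S.frameSet q₀) := by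
  have h : ∀ a b, ContMDiffOn 𝓘(ℝ, E) 𝓘(ℝ, ℝ) ∞
      (fun q => S.kinetic.inner q (S.frame q₀ a q) (S.frame q₀ b q)) (S.frameSet q₀) := by
    intro a b
    have h := ContMDiffOn.clm_bundle_apply₂ (E₃ := Bundle.Trivial Q ℝ)
      (E₁ := fun q : Q => TangentSpace 𝓘(ℝ, E) q) (E₂ := fun q : Q => TangentSpace 𝓘(ℝ, E) q)
      (b := fun q : Q => q) S.kinetic.contMDiff.contMDiffOn (S.contMDiffOn_frame q₀ a)
      (S.contMDiffOn_frame q₀ b)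
    intro p hp
    exact (contMDiffWithinAt_totalSpace.1 (h p hp)).2
  refine contMDiffOn_finsetSum fun a _ => contMDiffOn_finsetSum fun b _ => ?_
  exact (h a b).smul contMDiffOn_const

theorem contMDiffOn_ofCoord (q₀ : Q) :
    ContMDiffOn 𝓘(ℝ, E × (Fin r → ℝ)) (𝓘(ℝ, E).prod 𝓘(ℝ, E →L[ℝ] ℝ)) ∞ (S.ofCoord q₀)
      {y | y.1 ∈ (chartAt E q₀).target ∧ (chartAt E q₀).symm y.1 ∈ S.frameSet q₀} := by
  have hb : ContMDiffOn 𝓘(ℝ, E × (Fin r → ℝ)) 𝓘(ℝ, E) ∞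
      (fun y : E × (Fin r → ℝ) => (chartAt E q₀).symm y.1)
      {y | y.1 ∈ (chartAt E q₀).target ∧ (chartAt E q₀).symm y.1 ∈ S.frameSet q₀} :=
    (contMDiffOn_chart_symm (I := 𝓘(ℝ, E)) (x := q₀)).comp
      (contDiff_fst.contMDiff.contMDiffOn) fun y hy => hy.1
  have hg := (S.contMDiffOn_gram q₀).comp hb fun y hy => hy.2
  have hX := fun a => (S.contMDiffOn_frame q₀ a).comp hb fun y hy => hy.2
  have hc : ContMDiffOn 𝓘(ℝ, E × (Fin r → ℝ)) 𝓘(ℝ, Fin r → ℝ) ∞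
      (fun y : E × (Fin r → ℝ) => (S.gram q₀ ((chartAt E q₀).symm y.1)).inverse y.2)
      {y | y.1 ∈ (chartAt E q₀).target ∧ (chartAt E q₀).symm y.1 ∈ S.frameSet q₀} := by
    intro y hy
    obtain ⟨e, he⟩ := S.exists_gram_equiv q₀ hy.2
    have hi : ContMDiffAt 𝓘(ℝ, (Fin r → ℝ) →L[ℝ] (Fin r → ℝ))
        𝓘(ℝ, (Fin r → ℝ) →L[ℝ] (Fin r → ℝ)) ∞ ContinuousLinearMap.inverse
        (S.gram q₀ ((chartAt E q₀).symm y.1)) := by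
      rw [← he]
      exact (contDiffAt_map_inverse e).contMDiffAt
    exact (hi.comp_contMDiffWithinAt y (hg y hy)).clm_apply
      contDiff_snd.contMDiff.contMDiffAt.contMDiffWithinAt
  have hv : ContMDiffOn 𝓘(ℝ, E × (Fin r → ℝ)) (𝓘(ℝ, E).prod 𝓘(ℝ, E)) ∞
      (fun y : E × (Fin r → ℝ) => (⟨(chartAt E q₀).symm y.1,
        ∑ a, (S.gram q₀ ((chartAt E q₀).symm y.1)).inverse y.2 a •
          S.frame q₀ a ((chartAt E q₀).symm y.1)⟩ : TangentBundle 𝓘(ℝ, E) Q))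
      {y | y.1 ∈ (chartAt E q₀).target ∧ (chartAt E q₀).symm y.1 ∈ S.frameSet q₀} := by
    intro y hy
    refine contMDiffWithinAt_totalSpace.2 ⟨hb y hy, ?_⟩
    set t := trivializationAt E (TangentSpace 𝓘(ℝ, E) : Q → Type _) ((chartAt E q₀).symm y.1)
    have hsum : ContMDiffWithinAt 𝓘(ℝ, E × (Fin r → ℝ)) 𝓘(ℝ, E) ∞
        (fun y : E × (Fin r → ℝ) => ∑ a, (S.gram q₀ ((chartAt E q₀).symm y.1)).inverse y.2 a •
          (t ⟨(chartAt E q₀).symm y.1, S.frame q₀ a ((chartAt E q₀).symm y.1)⟩).2)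
        {y | y.1 ∈ (chartAt E q₀).target ∧ (chartAt E q₀).symm y.1 ∈ S.frameSet q₀} y := by
      refine contMDiffWithinAt_finsetSum fun a _ => ?_
      exact (contMDiffWithinAt_pi_space.1 (hc y hy) a).smul
        (contMDiffWithinAt_totalSpace.1 (hX a y hy)).2
    have ht : ∀ᶠ z in 𝓝[{y | y.1 ∈ (chartAt E q₀).target ∧
        (chartAt E q₀).symm y.1 ∈ S.frameSet q₀}] y, (chartAt E q₀).symm z.1 ∈ t.baseSet :=
      (hb y hy).continuousWithinAt.eventually
        (t.open_baseSet.mem_nhds (mem_baseSet_trivializationAt _ _ _))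
    refine hsum.congr_of_eventuallyEq_of_mem ?_ hy
    filter_upwards [ht] with z hz
    have hl : ∀ v : TangentSpace 𝓘(ℝ, E) ((chartAt E q₀).symm z.1),
        (t ⟨(chartAt E q₀).symm z.1, v⟩).2 = t.linearMapAt ℝ ((chartAt E q₀).symm z.1) v :=
      fun v => (congrFun (t.coe_linearMapAt_of_mem (R := ℝ) hz) v).symm
    rw [hl, map_sum]
    refine Finset.sum_congr rfl fun a _ => ?_
    rw [hl, map_smul]
  exact ContMDiffOn.clm_bundle_apply (E₂ := fun q : Q => TangentSpace 𝓘(ℝ, E) q →L[ℝ] ℝ)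
    (S.kinetic.contMDiff.comp_contMDiffOn hb) hv

theorem isOpen_coordBase (q₀ : Q) : IsOpen (S.coordBase q₀) :=
  (chartAt E q₀).open_source.inter (S.isOpen_frameSet q₀)

theorem continuous_τ : Continuous S.τ :=
  (Bundle.contMDiff_proj (n := ∞) (IB := 𝓘(ℝ, E)) (F := E →L[ℝ] ℝ)
    (fun q : Q => TangentSpace 𝓘(ℝ, E) q →L[ℝ] ℝ)).continuous.comp continuous_subtype_val

/-- The coordinates on `M` near the fibre over `q₀`. -/
noncomputable def coordChart (q₀ : Q) : OpenPartialHomeomorph S.M (E × (Fin r → ℝ)) where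
  toFun m := S.toCoord q₀ m.1
  invFun y := open Classical in
    if h : (chartAt E q₀).symm y.1 ∈ S.frameSet q₀ then ⟨S.ofCoord q₀ y, S.ofCoord_mem q₀ h⟩
    else ⟨⟨q₀, 0⟩, 0, zero_mem _, by simp⟩
  source := {m | S.τ m ∈ S.coordBase q₀}
  target := {y | y.1 ∈ (chartAt E q₀).target ∧ (chartAt E q₀).symm y.1 ∈ S.frameSet q₀}
  map_source' m hm := by
    refine ⟨(chartAt E q₀).map_source hm.1, ?_⟩
    change (chartAt E q₀).symm (chartAt E q₀ m.1.1) ∈ _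
    rw [(chartAt E q₀).left_inv (x := m.1.1) hm.1]
    exact hm.2
  map_target' y hy := by
    rw [dif_pos hy.2]
    exact ⟨(chartAt E q₀).map_target hy.1, hy.2⟩
  left_inv' m hm := by
    have h : (chartAt E q₀).symm (S.toCoord q₀ m.1).1 ∈ S.frameSet q₀ := by
      change (chartAt E q₀).symm (chartAt E q₀ m.1.1) ∈ _
      rw [(chartAt E q₀).left_inv (x := m.1.1) hm.1]
      exact hm.2
    rw [dif_pos h]
    exact Subtype.ext (S.ofCoord_toCoord q₀ m.2 hm)
  right_inv' y hy := by
    rw [dif_pos hy.2]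
    exact S.toCoord_ofCoord q₀ hy.1 hy.2
  open_source := (S.isOpen_coordBase q₀).preimage S.continuous_τ
  open_target := ((chartAt E q₀).isOpen_inter_preimage_symm
    (S.isOpen_frameSet q₀)).preimage continuous_fst
  continuousOn_toFun := (S.contMDiffOn_toCoord q₀).continuousOn.comp
    continuous_subtype_val.continuousOn fun _ hm => hm
  continuousOn_invFun := by
    rw [Topology.IsInducing.subtypeVal.continuousOn_iff]
    refine (S.contMDiffOn_ofCoord q₀).continuousOn.congr fun y hy => ?_
    simp only [Function.comp_apply]
    rw [dif_pos hy.2]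

noncomputable instance : ChartedSpace (E × (Fin r → ℝ)) S.M where
  atlas := Set.range S.coordChart
  chartAt m := S.coordChart (S.τ m)
  mem_chart_source m := ⟨mem_chart_source E (S.τ m), S.mem_frameSet (S.τ m)⟩
  chart_mem_atlas _ := ⟨_, rfl⟩

instance : IsManifold 𝓘(ℝ, E × (Fin r → ℝ)) ∞ S.M := by
  refine isManifold_of_contDiffOn _ _ _ ?_
  rintro _ _ ⟨q₀, rfl⟩ ⟨q₁, rfl⟩
  rw [← contMDiffOn_iff_contDiffOn]
  have h := (S.contMDiffOn_toCoord q₁).comp' (S.contMDiffOn_ofCoord q₀)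
  refine (h.mono fun y hy => ?_).congr fun y hy => ?_
  all_goals
    have hy' : y ∈ ((S.coordChart q₀).symm ≫ₕ S.coordChart q₁).source := hy.1
    rw [OpenPartialHomeomorph.trans_source] at hy'
    obtain ⟨h1, h2⟩ := hy'
    have h3 : ((S.coordChart q₀).symm y).1 = S.ofCoord q₀ y :=
      congrArg Subtype.val (dif_pos h1.2)
  · refine ⟨h1, ?_⟩
    change ((S.coordChart q₀).symm y).1.1 ∈ S.coordBase q₁ at h2
    rw [h3] at h2
    exact h2
  · change S.toCoord q₁ ((S.coordChart q₀).symm y).1 = _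
    rw [h3]
    rfl

/-! ### Symmetries -/

section Symmetry

variable (EG : Type*) [NormedAddCommGroup EG] [NormedSpace ℝ EG]
  (G : Type*) [TopologicalSpace G] [ChartedSpace EG G] [Group G]
  [MulAction G Q]

/-- The tangent lift `T_q g : T_q Q → T_{g q} Q` of the action. -/
noncomputable def tangentLift {G : Type*} [Group G] [MulAction G Q] (g : G) (q : Q) :
    TangentSpace 𝓘(ℝ, E) q →L[ℝ] TangentSpace 𝓘(ℝ, E) (g • q) :=
  mfderiv 𝓘(ℝ, E) 𝓘(ℝ, E) (fun x : Q => g • x) q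

/-- The Lie group `G`, modelled on `EG`, acts smoothly on `Q` and this action is a symmetry of the
nonholonomic system: its tangent lift leaves the lagrangian and the constraint distribution
invariant. -/
structure IsSymmetry : Prop where
  contMDiffSMul : ContMDiffSMul 𝓘(ℝ, EG) 𝓘(ℝ, E) ∞ G Q
  lagrangian_invariant : ∀ (g : G) (q : Q) (v : TangentSpace 𝓘(ℝ, E) q),
    S.lagrangian ⟨g • q, tangentLift g q v⟩ = S.lagrangian ⟨q, v⟩
  constraint_invariant : ∀ (g : G) (q : Q), ∀ v ∈ S.D q, tangentLift g q v ∈ S.D (g • q)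

variable {EG G}

/-- The cotangent lift `(q, p) ↦ (g q, p ∘ T (g⁻¹))` of the action. -/
noncomputable def cotangentLift {G : Type*} [Group G] [MulAction G Q] (g : G)
    (p : CotangentBundle E Q) : CotangentBundle E Q :=
  ⟨g • p.1, p.2.comp (mfderiv 𝓘(ℝ, E) 𝓘(ℝ, E) (fun x : Q => g⁻¹ • x) (g • p.1) :
    TangentSpace 𝓘(ℝ, E) (g • p.1) →L[ℝ] TangentSpace 𝓘(ℝ, E) p.1)⟩

variable {S}

theorem IsSymmetry.kinetic_invariant (h : S.IsSymmetry EG G) (g : G) (q : Q)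
    (v w : TangentSpace 𝓘(ℝ, E) q) :
    S.kinetic.inner (g • q) (tangentLift g q v) (tangentLift g q w) = S.kinetic.inner q v w := by
  have hU : S.potential (g • q) = S.potential q := by
    have := h.lagrangian_invariant g q 0
    simpa [lagrangian] using this
  have hd : ∀ u : TangentSpace 𝓘(ℝ, E) q,
      S.kinetic.inner (g • q) (tangentLift g q u) (tangentLift g q u)
        = S.kinetic.inner q u u := by
    intro u
    have := h.lagrangian_invariant g q u
    simp only [lagrangian, hU] at this
    linarith
  have h1 := hd (v + w)
  simp only [map_add, add_apply] at h1
  have h2 := hd v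
  have h3 := hd w
  have h4 := S.kinetic.symm (g • q) (tangentLift g q v) (tangentLift g q w)
  have h5 := S.kinetic.symm q v w
  linarith

theorem IsSymmetry.contMDiff_smul_left (h : S.IsSymmetry EG G) (g : G) :
    ContMDiff 𝓘(ℝ, E) 𝓘(ℝ, E) ∞ (fun x : Q => g • x) :=
  h.contMDiffSMul.contMDiff_smul.comp (contMDiff_const.prodMk contMDiff_id)

theorem IsSymmetry.tangentLift_inv (h : S.IsSymmetry EG G) (g : G) (q : Q)
    (w : TangentSpace 𝓘(ℝ, E) (g • q)) :
    tangentLift g q ((mfderiv 𝓘(ℝ, E) 𝓘(ℝ, E) (fun x : Q => g⁻¹ • x) (g • q) :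
      TangentSpace 𝓘(ℝ, E) (g • q) →L[ℝ] TangentSpace 𝓘(ℝ, E) q) w) = w := by
  have hn : (∞ : WithTop ℕ∞) ≠ 0 := by simp
  have hc := mfderiv_comp_apply (g • q)
    ((h.contMDiff_smul_left g).mdifferentiableAt (x := g⁻¹ • g • q) hn)
    ((h.contMDiff_smul_left g⁻¹).mdifferentiableAt (x := g • q) hn) w
  have hid : (fun x : Q => g • x) ∘ (fun x : Q => g⁻¹ • x) = id := by
    funext x
    simp
  rw [hid, mfderiv_id] at hc
  have key : ∀ q' : Q, q' = q → ∀ u : E,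
      (mfderiv 𝓘(ℝ, E) 𝓘(ℝ, E) (fun x : Q => g • x) q' : E →L[ℝ] E) u
        = (mfderiv 𝓘(ℝ, E) 𝓘(ℝ, E) (fun x : Q => g • x) q : E →L[ℝ] E) u := by
    rintro _ rfl u
    rfl
  exact (key _ (inv_smul_smul g q) _).symm.trans hc.symm

/-- The cotangent lift of a symmetry leaves `M` invariant. -/
theorem IsSymmetry.cotangentLift_mem (h : S.IsSymmetry EG G) (g : G) {p : CotangentBundle E Q}
    (hp : p ∈ S.constraintSet) : cotangentLift g p ∈ S.constraintSet := by
  obtain ⟨v, hv, hpv⟩ := hp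
  refine ⟨tangentLift g p.1 v, h.constraint_invariant g p.1 v hv, ?_⟩
  refine ContinuousLinearMap.ext fun w => ?_
  let u : TangentSpace 𝓘(ℝ, E) p.1 :=
    (mfderiv 𝓘(ℝ, E) 𝓘(ℝ, E) (fun x : Q => g⁻¹ • x) (g • p.1) :
      TangentSpace 𝓘(ℝ, E) (g • p.1) →L[ℝ] TangentSpace 𝓘(ℝ, E) p.1) w
  have h1 : p.2 u = S.kinetic.inner p.1 v u := by rw [hpv]
  have h2 := (h.kinetic_invariant g p.1 v u).symm
  have h3 := congrArg (S.kinetic.inner (g • p.1) (tangentLift g p.1 v)) (h.tangentLift_inv g p.1 w)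
  exact (h1.trans h2).trans h3

/-- The action `φ : G × M → M`, i.e. the restriction to `M` of the cotangent lift. -/
noncomputable def IsSymmetry.act (h : S.IsSymmetry EG G) (g : G) (m : S.M) : S.M :=
  ⟨cotangentLift g m.1, h.cotangentLift_mem g m.2⟩

variable (EG G) in
/-- The Lie algebra `𝔤 = T₁G`. -/
abbrev LieAlg : Type _ := GroupLieAlgebra 𝓘(ℝ, EG) G

/-- The infinitesimal generator `Ψ_q : 𝔤 → T_q Q`, `Ψ_q η = η_Q (q)`: the derivative at `1` of the
orbit map `g ↦ g q`. -/
noncomputable def genQ (q : Q) : LieAlg EG G →ₗ[ℝ] TangentSpace 𝓘(ℝ, E) q :=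
  (mfderiv 𝓘(ℝ, EG) 𝓘(ℝ, E) (fun g : G => g • q) 1 :
    LieAlg EG G →L[ℝ] TangentSpace 𝓘(ℝ, E) q).toLinearMap

/-- The adjoint action `Ad_g : 𝔤 → 𝔤`. -/
noncomputable def Ad (g : G) : LieAlg EG G →ₗ[ℝ] LieAlg EG G :=
  (mfderiv 𝓘(ℝ, EG) 𝓘(ℝ, EG) (fun x : G => g * x * g⁻¹) 1 :
    LieAlg EG G →L[ℝ] LieAlg EG G).toLinearMap

variable (EG G) in
/-- The vertical space `V_q`, tangent to the orbit of `q`. -/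
noncomputable def V (q : Q) : Submodule ℝ (TangentSpace 𝓘(ℝ, E) q) :=
  LinearMap.range (genQ (E := E) (EG := EG) (G := G) q)

variable (S EG G) in
/-- `(𝔤_S)_q = {ξ ∈ 𝔤 : ξ_Q (q) ∈ S_q}` where `S_q = D_q ∩ V_q`. -/
noncomputable def gS (q : Q) : Submodule ℝ (LieAlg EG G) :=
  (S.D q ⊓ V EG G q).comap (genQ q)

variable (S EG G) in
/-- `W` is a vertical complement of the constraints: `TQ = D ⊕ W` and `W ⊆ V`. -/
structure IsVerticalComplement (W : ∀ q : Q, Submodule ℝ (TangentSpace 𝓘(ℝ, E) q)) : Prop where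
  isCompl : ∀ q, IsCompl (S.D q) (W q)
  le_vertical : ∀ q, W q ≤ V EG G q

/-- The vertical-symmetry condition for `W`, with the subspace `𝔴 ⊆ 𝔤`: `𝔴` is `Ad`-invariant and
`Ψ` restricts to an isomorphism `𝔴 × Q ≅ W`. -/
structure VerticalSymmetry (W : ∀ q : Q, Submodule ℝ (TangentSpace 𝓘(ℝ, E) q))
    (𝔴 : Submodule ℝ (LieAlg EG G)) : Prop where
  ad_mem : ∀ (g : G), ∀ η ∈ 𝔴, Ad g η ∈ 𝔴
  injOn : ∀ q : Q, Set.InjOn (genQ (E := E) (EG := EG) (G := G) q) 𝔴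
  map_eq : ∀ q : Q, 𝔴.map (genQ q) = W q

/-- `𝔤 × Q = 𝔤_S ⊕ (𝔴 × Q)`. -/
theorem isCompl_gS {W : ∀ q : Q, Submodule ℝ (TangentSpace 𝓘(ℝ, E) q)}
    {𝔴 : Submodule ℝ (LieAlg EG G)} (hW : S.IsVerticalComplement EG G W)
    (h𝔴 : VerticalSymmetry W 𝔴) (q : Q) : IsCompl (S.gS EG G q) 𝔴 := by
  constructor
  · rw [Submodule.disjoint_def]
    intro η h1 h2
    have h3 : genQ q η ∈ W q := by
      rw [← h𝔴.map_eq q]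
      exact Submodule.mem_map_of_mem h2
    have h4 : genQ q η = 0 := Submodule.disjoint_def.1 (hW.isCompl q).disjoint _ h1.1 h3
    exact h𝔴.injOn q h2 (zero_mem 𝔴) (h4.trans (map_zero _).symm)
  · rw [codisjoint_iff, eq_top_iff]
    intro η _
    have h1 : genQ q η ∈ S.D q ⊔ W q := by
      rw [(hW.isCompl q).sup_eq_top]
      trivial
    obtain ⟨d, hd, w, hw, hdw⟩ := Submodule.mem_sup.1 h1
    rw [← h𝔴.map_eq q] at hw
    obtain ⟨ζ, hζ, rfl⟩ := hw
    refine Submodule.mem_sup.2 ⟨η - ζ, ?_, ζ, hζ, sub_add_cancel _ _⟩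
    refine ⟨?_, LinearMap.mem_range_self _ _⟩
    change genQ q (η - ζ) ∈ S.D q
    rw [map_sub, ← hdw, add_sub_cancel_right]
    exact hd

/-- The projection `P_{𝔤_S} : 𝔤 × Q → 𝔤_S` along `𝔴 × Q`, over `q`. -/
noncomputable def projGS {W : ∀ q : Q, Submodule ℝ (TangentSpace 𝓘(ℝ, E) q)}
    {𝔴 : Submodule ℝ (LieAlg EG G)} (hW : S.IsVerticalComplement EG G W)
    (h𝔴 : VerticalSymmetry W 𝔴) (q : Q) : LieAlg EG G →ₗ[ℝ] S.gS EG G q :=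
  (S.gS EG G q).projectionOnto 𝔴 (isCompl_gS hW h𝔴 q)

end Symmetry

/-! ### Geometry of `M` -/

section Constraint

/-- The tangent space `T_m M`. -/
abbrev TM (m : S.M) : Type _ := TangentSpace 𝓘(ℝ, E × (Fin r → ℝ)) m

/-- The canonical 1-form of `T*Q`: `Θ_Q (v) = p (Tπ v)` for `v ∈ T_{(q, p)} T*Q`. -/
noncomputable def canonicalOneForm (p : CotangentBundle E Q) :
    TangentSpace (𝓘(ℝ, E).prod 𝓘(ℝ, E →L[ℝ] ℝ)) p →ₗ[ℝ] ℝ :=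
  p.2.toLinearMap.comp (mfderiv (𝓘(ℝ, E).prod 𝓘(ℝ, E →L[ℝ] ℝ)) 𝓘(ℝ, E)
    (fun p : CotangentBundle E Q => p.1) p).toLinearMap

/-- The canonical 2-form of `T*Q`: `Ω_Q = - dΘ_Q`. -/
noncomputable def canonicalTwoForm (p : CotangentBundle E Q) :
    TangentSpace (𝓘(ℝ, E).prod 𝓘(ℝ, E →L[ℝ] ℝ)) p →ₗ[ℝ]
      TangentSpace (𝓘(ℝ, E).prod 𝓘(ℝ, E →L[ℝ] ℝ)) p →ₗ[ℝ] ℝ :=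
  -extDerivForm (𝓘(ℝ, E).prod 𝓘(ℝ, E →L[ℝ] ℝ)) canonicalOneForm p

/-- The tangent map `Tι` of the inclusion `ι : M → T*Q`. -/
noncomputable def tangentIncl (m : S.M) :
    S.TM m →ₗ[ℝ] TangentSpace (𝓘(ℝ, E).prod 𝓘(ℝ, E →L[ℝ] ℝ)) (S.incl m) :=
  (mfderiv 𝓘(ℝ, E × (Fin r → ℝ)) (𝓘(ℝ, E).prod 𝓘(ℝ, E →L[ℝ] ℝ)) S.incl m).toLinearMap

/-- `Θ_M = ι^* Θ_Q`. -/
noncomputable def ΘM (m : S.M) : S.TM m →ₗ[ℝ] ℝ :=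
  (canonicalOneForm (S.incl m)).comp (S.tangentIncl m)

/-- `Ω_M = ι^* Ω_Q`. -/
noncomputable def ΩM (m : S.M) : S.TM m →ₗ[ℝ] S.TM m →ₗ[ℝ] ℝ :=
  (canonicalTwoForm (S.incl m)).compl₁₂ (S.tangentIncl m) (S.tangentIncl m)

/-- The distribution `C_m = {v ∈ T_m M : Tτ v ∈ D}` on `M`. -/
noncomputable def C (m : S.M) : Submodule ℝ (S.TM m) :=
  (S.D (S.τ m)).comap (mfderiv 𝓘(ℝ, E × (Fin r → ℝ)) 𝓘(ℝ, E) S.τ m).toLinearMap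

open Classical in
/-- `π_nh^♯ (α) = - X`, where `X` is the unique section of `C` with `i_X Ω_M |_C = α |_C`. -/
noncomputable def piSharp (α : ∀ m : S.M, S.TM m →ₗ[ℝ] ℝ) (m : S.M) : S.TM m :=
  if h : ∃! X : S.TM m, X ∈ S.C m ∧ ∀ Y ∈ S.C m, S.ΩM m X Y = α m Y then -h.choose else 0

variable {S}
variable {EG : Type*} [NormedAddCommGroup EG] [NormedSpace ℝ EG]
  {G : Type*} [TopologicalSpace G] [ChartedSpace EG G] [Group G] [MulAction G Q]
  (h : S.IsSymmetry EG G) (𝔴 : Submodule ℝ (LieAlg EG G))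

/-- The infinitesimal generator `η ↦ η_M (m)` of the action on `M`. -/
noncomputable def IsSymmetry.genM (m : S.M) : LieAlg EG G →ₗ[ℝ] S.TM m :=
  (mfderiv 𝓘(ℝ, EG) 𝓘(ℝ, E × (Fin r → ℝ)) (fun g : G => h.act g m) 1 :
    LieAlg EG G →L[ℝ] S.TM m).toLinearMap

/-- The restriction to `𝔴` of `η ↦ η_M (m)`. -/
noncomputable def IsSymmetry.genM𝔴 (m : S.M) : 𝔴 →ₗ[ℝ] S.TM m :=
  (h.genM m).comp 𝔴.subtype

/-- The distribution `𝓦_m = span {η_M (m) : η ∈ 𝔴}` on `M`. -/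
noncomputable def IsSymmetry.WM (m : S.M) : Submodule ℝ (S.TM m) :=
  LinearMap.range (h.genM𝔴 𝔴 m)

open Classical in
/-- The projection `P_C` along `𝓦`, for the decomposition `TM = C ⊕ 𝓦`. -/
noncomputable def IsSymmetry.projC (m : S.M) : S.TM m →ₗ[ℝ] S.TM m :=
  if hc : IsCompl (S.C m) (h.WM 𝔴 m) then (S.C m).projection (h.WM 𝔴 m) hc else 0

open Classical in
/-- The projection `P_𝓦` along `C`, for the decomposition `TM = C ⊕ 𝓦`. -/
noncomputable def IsSymmetry.projW (m : S.M) : S.TM m →ₗ[ℝ] h.WM 𝔴 m :=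
  if hc : IsCompl (S.C m) (h.WM 𝔴 m) then (h.WM 𝔴 m).projectionOnto (S.C m) hc.symm else 0

open Classical in
/-- The 1-form `A_𝓦 : TM → 𝔤` with `A_𝓦 (v) = ξ ∈ 𝔴` if and only if `P_𝓦 (v) = ξ_M (m)`. Its values
are regarded as elements of the model space of `G`, which is the vector space underlying
`𝔤 = T₁G`. -/
noncomputable def IsSymmetry.AW (m : S.M) : S.TM m →ₗ[ℝ] EG :=
  if hi : Function.Injective (h.genM𝔴 𝔴 m) then
    (𝔴.subtype.comp ((LinearEquiv.ofInjective (h.genM𝔴 𝔴 m) hi).symm.toLinearMap.comp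
      (h.projW 𝔴 m)) : S.TM m →ₗ[ℝ] LieAlg EG G)
  else 0

/-- The `𝓦`-curvature `K_𝓦 (X, Y) = dA_𝓦 (P_C X, P_C Y)`. -/
noncomputable def IsSymmetry.KW (m : S.M) : S.TM m →ₗ[ℝ] S.TM m →ₗ[ℝ] LieAlg EG G :=
  (extDerivForm 𝓘(ℝ, E × (Fin r → ℝ)) (h.AW 𝔴) m).compl₁₂ (h.projC 𝔴 m) (h.projC 𝔴 m)

variable (EG G) in
/-- The canonical momentum map `J_Q : T*Q → 𝔤^*`, `⟨J_Q (q, p), η⟩ = p (η_Q (q))`. -/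
noncomputable def momentumQ (p : CotangentBundle E Q) : LieAlg EG G →ₗ[ℝ] ℝ :=
  p.2.toLinearMap.comp (genQ p.1)

variable (S EG G) in
/-- `𝓙 = ι^* J_Q : M → 𝔤^*`. -/
noncomputable def momentumM (m : S.M) : LieAlg EG G →ₗ[ℝ] ℝ :=
  momentumQ EG G (S.incl m)

/-- The 2-form `⟨𝓙, K_𝓦⟩` on `M`. -/
noncomputable def IsSymmetry.JK (m : S.M) : S.TM m →ₗ[ℝ] S.TM m →ₗ[ℝ] ℝ :=
  (h.KW 𝔴 m).compr₂ (S.momentumM EG G m)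

/-- The vector field `ξ_M` on `M` of a section `ξ` of `𝔤_S`: `ξ_M (m) = (ξ_{τ m})_M (m)`. -/
noncomputable def IsSymmetry.sectionGen (ξ : ∀ q : Q, S.gS EG G q) (m : S.M) : S.TM m :=
  h.genM m (ξ (S.τ m))

/-- Smoothness of a section `ξ` of `𝔤_S`, i.e. of the corresponding map from `Q` to `𝔤` (whose
underlying vector space is the model space of `G`). -/
def IsSmoothSection (ξ : ∀ q : Q, S.gS EG G q) : Prop :=
  let x : Q → EG := fun q => (ξ q).val
  ContMDiff 𝓘(ℝ, E) 𝓘(ℝ, EG) ∞ x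

/-- The nonholonomic momentum map `J^nh (m) ∈ (𝔤_S)^*_{τ m}`: `⟨J^nh, ξ⟩ = i_{ξ_M} Θ_M`. -/
noncomputable def IsSymmetry.Jnh (m : S.M) : S.gS EG G (S.τ m) →ₗ[ℝ] ℝ :=
  (S.ΘM m).comp ((h.genM m).comp (S.gS EG G (S.τ m)).subtype)

/-- The function `⟨J^nh, ξ⟩` on `M`, for a section `ξ` of `𝔤_S`. -/
noncomputable def IsSymmetry.nhMomentum (ξ : ∀ q : Q, S.gS EG G q) (m : S.M) : ℝ :=
  h.Jnh m (ξ (S.τ m))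

/-- The 1-form `Λ = Σ_i (j_i df_i + f_i i_{(ξ_i)_M} ⟨𝓙, K_𝓦⟩)` on `M`, where `j_i = ⟨J^nh, ξ_i⟩` and
where `f_i ∈ C^∞(Q)` is regarded as the function `f_i ∘ τ` on `M`. -/
noncomputable def IsSymmetry.lambdaForm {k : ℕ} (ξ : Fin k → ∀ q : Q, S.gS EG G q)
    (f : Fin k → Q → ℝ) (m : S.M) : S.TM m →ₗ[ℝ] ℝ :=
  ∑ i, (h.nhMomentum (ξ i) m • differential 𝓘(ℝ, E × (Fin r → ℝ)) (fun m' : S.M => f i (S.τ m')) m +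
    f i (S.τ m) • h.JK 𝔴 m (h.sectionGen (ξ i) m))

end Constraint

end NHSystem
end Nonholonomic

/-! On `C` the map `piSharp` inverts Ω_M up to sign, so the claim says that χ_M lies in C and that
Ω_M(χ_M, Y) = (dJ - Λ)(Y) for Y in C. By Leibniz' rule the terms j_i df_i in Λ are exactly the
difference between dJ and Σ f_i dj_i. It therefore suffices to treat a single section ξ = P_{𝔤_S}(θ)
with θ ∈ 𝔤 constant, and to prove on C that i_{ξ_M} Ω_M = d⟨J^nh, ξ⟩ - i_{ξ_M}⟨𝓙, K_𝓦⟩; this is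
`ΩM_sectionGen`.

Fix m and freeze ξ₀ = ξ(τ m). The cotangent lift preserves Θ_Q, which gives the usual momentum
identity i_{(ξ₀)_M} Ω_M = d⟨𝓙, ξ₀⟩ (`ΩM_genM`). The function ⟨J^nh, ξ⟩ is ⟨𝓙, ξ⟩ with ξ varying, so
its differential at m has the additional term ⟨𝓙, dξ⟩ (`modelDeriv_nhMomentum`).

This additional term is the curvature term (`extDerivForm_AW`). The action preserves C, the kernel
of A_𝓦, so Cartan's formula gives dA_𝓦((ξ₀)_M, Y) = -Y(A_𝓦((ξ₀)_M)) for Y in C. Since θ - ξ has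
values in 𝔴, so does ξ₀ - ξ∘τ, while ξ_M lies in C. Hence A_𝓦((ξ₀)_M) = ξ₀ - ξ∘τ, and its derivative
along Y is -dξ(Y).

Both identities are instances of `extDerivForm_generator`, which asks only that the value of the
form on one vector be preserved. Nondegeneracy of Ω_M on C (`existsUnique_ΩM`) comes from positivity
of κ, and differentiability of A_𝓦 from the local connection form of `exists_connection`. -/

namespace Nonholonomic

/-! ### Cartan's formula in normed spaces. -/

section Calculus

variable {V E' F : Type*} [NormedAddCommGroup V] [NormedSpace ℝ V]
  [NormedAddCommGroup E'] [NormedSpace ℝ E'] [NormedAddCommGroup F] [NormedSpace ℝ F]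

/-- Cartan's formula in a vector space: if a family `Φ (s, ·)` of transformations with
`Φ (s₀, ·) = id` preserves the value of the 1-form `β` on `v`, then `dβ (a, v) = - d(β(a)) v` for the
generator `a` of the family in the direction `η`. -/
theorem fderiv_sub_fderiv_of_invariant {Φ : V × E' → E'} {s₀ : V} {y₀ : E'}
    (hΦ : ContDiffAt ℝ 2 Φ (s₀, y₀)) (hid : ∀ᶠ y in 𝓝 y₀, Φ (s₀, y) = y)
    {β : E' → E' →L[ℝ] F} (hβ : DifferentiableAt ℝ β y₀) {v : E'} {c : F}
    (hinv : ∀ᶠ s in 𝓝 s₀, β (Φ (s, y₀)) (fderiv ℝ (fun y => Φ (s, y)) y₀ v) = c) (η : V) :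
    fderiv ℝ β y₀ (fderiv ℝ (fun s => Φ (s, y₀)) s₀ η) v -
      fderiv ℝ β y₀ v (fderiv ℝ (fun s => Φ (s, y₀)) s₀ η) =
      -fderiv ℝ (fun y => β y (fderiv ℝ (fun s => Φ (s, y)) s₀ η)) y₀ v := by
  have hd : ∀ᶠ p in 𝓝 (s₀, y₀), DifferentiableAt ℝ Φ p :=
    (hΦ.eventually (by simp)).mono fun p hp => hp.differentiableAt (by simp)
  have hd1 : ∀ᶠ s in 𝓝 s₀, DifferentiableAt ℝ Φ (s, y₀) :=
    (Continuous.prodMk_left y₀).continuousAt.eventually hd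
  have hd2 : ∀ᶠ y in 𝓝 y₀, DifferentiableAt ℝ Φ (s₀, y) :=
    (Continuous.prodMk_right s₀).continuousAt.eventually hd
  have hp1 : ∀ s y, DifferentiableAt ℝ Φ (s, y) →
      HasFDerivAt (fun s => Φ (s, y)) ((fderiv ℝ Φ (s, y)).comp (.inl ℝ V E')) s :=
    fun s y h => h.hasFDerivAt.comp s (hasFDerivAt_prodMk_left s y)
  have hp2 : ∀ s y, DifferentiableAt ℝ Φ (s, y) →
      HasFDerivAt (fun y => Φ (s, y)) ((fderiv ℝ Φ (s, y)).comp (.inr ℝ V E')) y :=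
    fun s y h => h.hasFDerivAt.comp y (hasFDerivAt_prodMk_right s y)
  have hΦ' : HasFDerivAt (fderiv ℝ Φ) (fderiv ℝ (fderiv ℝ Φ) (s₀, y₀)) (s₀, y₀) :=
    ((hΦ.fderiv_right (m := 1) (by norm_num)).differentiableAt (by simp)).hasFDerivAt
  -- Differentiating the invariance in s and differentiating β(generator) in y both produce the
  -- mixed second derivative of Φ, in opposite orders. Its symmetry is the reason for requiring C²
  -- regularity.
  have hsymm := (hΦ.isSymmSndFDerivAt (by simp)) (η, 0) (0, v)
  have h0 : Φ (s₀, y₀) = y₀ := hid.self_of_nhds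
  have h2 : (fderiv ℝ Φ (s₀, y₀)).comp (.inr ℝ V E') = .id ℝ E' := by
    rw [← (hp2 _ _ hd.self_of_nhds).fderiv]
    exact (Filter.EventuallyEq.fderiv_eq hid).trans fderiv_id
  set a := fderiv ℝ Φ (s₀, y₀) (η, 0) with ha
  have ha' : fderiv ℝ (fun s => Φ (s, y₀)) s₀ η = a := by
    rw [(hp1 _ _ hd.self_of_nhds).fderiv]; rfl
  -- the derivative of the constant in the direction `η`
  have hβ' : HasFDerivAt β (fderiv ℝ β y₀) (Φ (s₀, y₀)) := by rw [h0]; exact hβ.hasFDerivAt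
  have e1 : HasFDerivAt (fun s => β (Φ (s, y₀)) (fderiv ℝ Φ (s, y₀) (0, v)))
      ((β (Φ (s₀, y₀))).comp ((((ContinuousLinearMap.apply ℝ E' ((0, v) : V × E')).comp
        (fderiv ℝ (fderiv ℝ Φ) (s₀, y₀)))).comp (.inl ℝ V E')) +
        ((fderiv ℝ β y₀).comp ((fderiv ℝ Φ (s₀, y₀)).comp (.inl ℝ V E'))).flip
          (fderiv ℝ Φ (s₀, y₀) (0, v))) s₀ := by
    refine (hβ'.comp s₀ (hp1 _ _ hd.self_of_nhds)).clm_apply ?_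
    exact HasFDerivAt.comp (g := fun p => fderiv ℝ Φ p ((0, v) : V × E')) s₀
      ((ContinuousLinearMap.apply ℝ E' ((0, v) : V × E')).hasFDerivAt.comp _ hΦ')
      (hasFDerivAt_prodMk_left s₀ y₀)
  have e1' : HasFDerivAt (fun s => β (Φ (s, y₀)) (fderiv ℝ Φ (s, y₀) (0, v)))
      (0 : V →L[ℝ] F) s₀ := by
    refine (hasFDerivAt_const c s₀).congr_of_eventuallyEq ?_
    filter_upwards [hd1, hinv] with s hs hs'
    rw [← hs', (hp2 _ _ hs).fderiv]
    rfl
  have k1 := DFunLike.congr_fun (e1.unique e1') η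
  have e2 : HasFDerivAt (fun y => β y (fderiv ℝ Φ (s₀, y) (η, 0)))
      ((β y₀).comp ((((ContinuousLinearMap.apply ℝ E' ((η, 0) : V × E')).comp
        (fderiv ℝ (fderiv ℝ Φ) (s₀, y₀)))).comp (.inr ℝ V E')) +
        (fderiv ℝ β y₀).flip a) y₀ := by
    refine hβ.hasFDerivAt.clm_apply ?_
    exact HasFDerivAt.comp (g := fun p => fderiv ℝ Φ p ((η, 0) : V × E')) y₀
      ((ContinuousLinearMap.apply ℝ E' ((η, 0) : V × E')).hasFDerivAt.comp _ hΦ')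
      (hasFDerivAt_prodMk_right s₀ y₀)
  have e2' : fderiv ℝ (fun y => β y (fderiv ℝ (fun s => Φ (s, y)) s₀ η)) y₀ =
      fderiv ℝ (fun y => β y (fderiv ℝ Φ (s₀, y) (η, 0))) y₀ := by
    refine Filter.EventuallyEq.fderiv_eq ?_
    filter_upwards [hd2] with y hy
    rw [(hp1 _ _ hy).fderiv]
    rfl
  rw [e2', e2.fderiv, ha']
  have h2v : fderiv ℝ Φ (s₀, y₀) (0, v) = v := DFunLike.congr_fun h2 v
  have k1' : β y₀ (fderiv ℝ (fderiv ℝ Φ) (s₀, y₀) (η, 0) (0, v)) + fderiv ℝ β y₀ a v = 0 := by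
    have : (β (Φ (s₀, y₀))) (fderiv ℝ (fderiv ℝ Φ) (s₀, y₀) (η, 0) (0, v)) +
      fderiv ℝ β y₀ (fderiv ℝ Φ (s₀, y₀) (η, 0)) (fderiv ℝ Φ (s₀, y₀) (0, v)) = 0 := k1
    rwa [h0, h2v] at this
  change _ = -(β y₀ (fderiv ℝ (fderiv ℝ Φ) (s₀, y₀) (0, v) (η, 0)) + fderiv ℝ β y₀ v a)
  rw [← hsymm]
  have := eq_neg_of_add_eq_zero_right k1'
  rw [this]
  abel

end Calculus

/-! ### Tangent maps read in charts. -/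

section Charts

variable {E' : Type*} [NormedAddCommGroup E'] [NormedSpace ℝ E']
  {H : Type*} [TopologicalSpace H] {I : ModelWithCorners ℝ E' H} [I.Boundaryless]
  {N : Type*} [TopologicalSpace N] [ChartedSpace H N] [IsManifold I 1 N]

theorem mdifferentiableAt_extChartAt_symm {x₀ : N} {y : E'} (hy : y ∈ (extChartAt I x₀).target) :
    MDifferentiableAt 𝓘(ℝ, E') I (extChartAt I x₀).symm y := by
  have h := mdifferentiableWithinAt_extChartAt_symm (I := I) hy
  rwa [I.range_eq_univ, mdifferentiableWithinAt_univ] at h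

theorem mfderiv_extChartAt_symm_self (x : N) :
    mfderiv 𝓘(ℝ, E') I (extChartAt I x).symm (extChartAt I x x) = ContinuousLinearMap.id ℝ E' := by
  have h := mfderivWithin_range_extChartAt_symm (I := I) (x := x)
  rwa [I.range_eq_univ, mfderivWithin_univ] at h

theorem mfderiv_extChartAt_symm_extChartAt {x₀ x : N} (hx : x ∈ (extChartAt I x₀).source)
    (v : TangentSpace I x) :
    mfderiv 𝓘(ℝ, E') I (extChartAt I x₀).symm (extChartAt I x₀ x)
      (mfderiv I 𝓘(ℝ, E') (extChartAt I x₀) x v) = v := by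
  have h := mfderivWithin_extChartAt_symm_comp_mfderiv_extChartAt' (I := I) hx
  rw [I.range_eq_univ, mfderivWithin_univ] at h
  exact DFunLike.congr_fun h v

variable {E₂ : Type*} [NormedAddCommGroup E₂] [NormedSpace ℝ E₂]
  {H₂ : Type*} [TopologicalSpace H₂] {I₂ : ModelWithCorners ℝ E₂ H₂}
  {N₂ : Type*} [TopologicalSpace N₂] [ChartedSpace H₂ N₂] [IsManifold I₂ 1 N₂]

variable (I I₂) in
/-- The tangent map of `f` at `x`, as a map between the model spaces. -/
noncomputable def modelDeriv (f : N → N₂) (x : N) : E' →L[ℝ] E₂ := mfderiv I I₂ f x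

/-- The tangent map at `x`, with respect to the preferred charts at `x` and `f x`. -/
theorem modelDeriv_eq_fderiv {f : N → N₂} {x : N} (hf : MDifferentiableAt I I₂ f x) :
    modelDeriv I I₂ f x = fderiv ℝ (fun y => extChartAt I₂ (f x) (f ((extChartAt I x).symm y)))
      (extChartAt I x x) := by
  rw [modelDeriv, hf.mfderiv, I.range_eq_univ, fderivWithin_univ]
  rfl

/-- The derivative of `f` written in charts that need not be the preferred ones. -/
theorem hasFDerivAt_chart {f : N → N₂} {x₀ : N} {z₀ : N₂} {y : E'}
    (hy : y ∈ (extChartAt I x₀).target)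
    (hz : f ((extChartAt I x₀).symm y) ∈ (extChartAt I₂ z₀).source)
    (hf : MDifferentiableAt I I₂ f ((extChartAt I x₀).symm y)) :
    HasFDerivAt (fun y => extChartAt I₂ z₀ (f ((extChartAt I x₀).symm y)))
      (((modelDeriv I₂ 𝓘(ℝ, E₂) (extChartAt I₂ z₀) (f ((extChartAt I x₀).symm y))).comp
        (modelDeriv I I₂ f ((extChartAt I x₀).symm y))).comp
        (modelDeriv 𝓘(ℝ, E') I (extChartAt I x₀).symm y)) y := by
  have h1 := (mdifferentiableAt_extChartAt (I := I₂) (by rwa [extChartAt_source] at hz) :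
    MDifferentiableAt I₂ 𝓘(ℝ, E₂) (extChartAt I₂ z₀) (f ((extChartAt I x₀).symm y)))
  exact ((h1.hasMFDerivAt.comp _ hf.hasMFDerivAt).comp y
    (mdifferentiableAt_extChartAt_symm hy).hasMFDerivAt).hasFDerivAt

end Charts

/-! ### Exterior derivatives evaluated on generators. -/

section Forms

variable {E' : Type*} [NormedAddCommGroup E'] [NormedSpace ℝ E'] [FiniteDimensional ℝ E']
  {H : Type*} [TopologicalSpace H] {I : ModelWithCorners ℝ E' H} [I.Boundaryless]
  {N : Type*} [TopologicalSpace N] [ChartedSpace H N] [IsManifold I 1 N]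
  {F : Type*} [NormedAddCommGroup F] [NormedSpace ℝ F]

/-- The preferred chart at `x` has the identity as its tangent map at `x`, so the transport by this
chart in the definition of `extDerivForm` disappears. -/
theorem extDerivForm_apply (α : ∀ x : N, TangentSpace I x →ₗ[ℝ] F) (x : N)
    (u v : TangentSpace I x) :
    extDerivForm I α x u v = fderiv ℝ (chartForm I α x) (extChartAt I x x) u v -
      fderiv ℝ (chartForm I α x) (extChartAt I x x) v u := by
  have h := mfderiv_extChartAt_self (I := I) (x := x)
  have hu : mfderiv I 𝓘(ℝ, E') (extChartAt I x) x u = u := DFunLike.congr_fun h u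
  have hv : mfderiv I 𝓘(ℝ, E') (extChartAt I x) x v = v := DFunLike.congr_fun h v
  change fderiv ℝ (chartForm I α x) (extChartAt I x x) (mfderiv I 𝓘(ℝ, E') (extChartAt I x) x u)
      (mfderiv I 𝓘(ℝ, E') (extChartAt I x) x v) -
    fderiv ℝ (chartForm I α x) (extChartAt I x x) (mfderiv I 𝓘(ℝ, E') (extChartAt I x) x v)
      (mfderiv I 𝓘(ℝ, E') (extChartAt I x) x u) = _
  rw [hu, hv]

theorem chartForm_mfderiv (α : ∀ x : N, TangentSpace I x →ₗ[ℝ] F) {x₀ x : N}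
    (hx : x ∈ (extChartAt I x₀).source) (v : TangentSpace I x) :
    chartForm I α x₀ (extChartAt I x₀ x) (mfderiv I 𝓘(ℝ, E') (extChartAt I x₀) x v) = α x v := by
  have key : ∀ (z : N), z = x → ∀ w : E', w = v →
      (α z : E' →ₗ[ℝ] F) w = (α x : E' →ₗ[ℝ] F) v := by
    rintro z rfl w rfl; rfl
  exact key _ ((extChartAt I x₀).left_inv hx) _ (mfderiv_extChartAt_symm_extChartAt hx v)

variable {EP : Type*} [NormedAddCommGroup EP] [NormedSpace ℝ EP]
  {P : Type*} [TopologicalSpace P] [ChartedSpace EP P] [IsManifold 𝓘(ℝ, EP) 1 P]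

/-- Cartan's formula: if a family `Φ g` of transformations of `N` with `Φ e = id` preserves the value
of the 1-form `α` on `v`, then `dα (X, v) = - d(α(X)) v` for every generator `X` of the family. -/
theorem extDerivForm_generator {Φ : P → N → N} {e : P} {x : N} (he : ∀ z, Φ e z = z)
    (hΦ : ContMDiffAt (𝓘(ℝ, EP).prod I) I 2 (Function.uncurry Φ) (e, x))
    (α : ∀ x : N, TangentSpace I x →ₗ[ℝ] F)
    (hα : DifferentiableAt ℝ (chartForm I α x) (extChartAt I x x)) (v : E')
    (hinv : ∀ᶠ g in 𝓝 e, α (Φ g x) (mfderiv I I (Φ g) x v) = α x v) (η : EP)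
    (X : ∀ z : N, TangentSpace I z)
    (hX : ∀ z, X z = (mfderiv 𝓘(ℝ, EP) I (fun g => Φ g z) e : EP →L[ℝ] E') η) :
    extDerivForm I α x (X x) v =
      -fderiv ℝ (fun y => α ((extChartAt I x).symm y) (X ((extChartAt I x).symm y)))
        (extChartAt I x x) v := by
  set ψ := extChartAt I x with hψ
  set ρ := extChartAt 𝓘(ℝ, EP) e with hρ
  have hex : Φ e x = x := he x
  have hψs : ψ.symm (ψ x) = x := ψ.left_inv (mem_extChartAt_source x)
  have hρs : ρ.symm (ρ e) = e := ρ.left_inv (mem_extChartAt_source e)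
  set Ψ : EP × E' → E' := fun p => ψ (Φ (ρ.symm p.1) (ψ.symm p.2)) with hΨ
  -- As `Φ e x = x`, the same chart at `x` serves for the source and for the target, and `Ψ` is a
  -- family of self-maps of the model space.
  have hsm : ContDiffAt ℝ 2 Ψ (ρ e, ψ x) := by
    have h := (contMDiffAt_iff.1 hΦ).2
    rw [ModelWithCorners.range_eq_univ, contDiffWithinAt_univ] at h
    simp only [extChartAt_prod, Function.uncurry, hex] at h
    exact h
  have hev : ∀ᶠ p in 𝓝 (e, x), MDifferentiableAt (𝓘(ℝ, EP).prod I) I (Function.uncurry Φ) p ∧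
      Φ p.1 p.2 ∈ ψ.source ∧ p.1 ∈ ρ.source ∧ p.2 ∈ ψ.source := by
    have h1 : ∀ᶠ p in 𝓝 (e, x), ContMDiffAt (𝓘(ℝ, EP).prod I) I 1 (Function.uncurry Φ) p := by
      rw [← contMDiffAt_iff_contMDiffAt_nhds (by simp)]
      exact hΦ.of_le (by norm_num)
    have h2 : ∀ᶠ p in 𝓝 (e, x), Φ p.1 p.2 ∈ ψ.source := by
      refine hΦ.continuousAt.eventually_mem (x := (e, x)) (s := ψ.source) ?_
      change _ ∈ 𝓝 (Φ e x)
      rw [hex]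
      exact extChartAt_source_mem_nhds x
    have h3 : ∀ᶠ p in 𝓝 (e, x), p.1 ∈ ρ.source :=
      continuousAt_fst.eventually_mem (extChartAt_source_mem_nhds e)
    have h4 : ∀ᶠ p in 𝓝 (e, x), p.2 ∈ ψ.source :=
      continuousAt_snd.eventually_mem (extChartAt_source_mem_nhds x)
    filter_upwards [h1, h2, h3, h4] with p h1 h2 h3 h4
    exact ⟨h1.mdifferentiableAt (by simp), h2, h3, h4⟩
  have hev1 : ∀ᶠ g in 𝓝 e, MDifferentiableAt (𝓘(ℝ, EP).prod I) I (Function.uncurry Φ) (g, x) ∧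
      Φ g x ∈ ψ.source ∧ g ∈ ρ.source :=
    ((Continuous.prodMk_left x).continuousAt.eventually hev).mono fun g h => ⟨h.1, h.2.1, h.2.2.1⟩
  have hev2 : ∀ᶠ z in 𝓝 x, MDifferentiableAt (𝓘(ℝ, EP).prod I) I (Function.uncurry Φ) (e, z) ∧
      z ∈ ψ.source :=
    ((Continuous.prodMk_right e).continuousAt.eventually hev).mono fun g h => ⟨h.1, h.2.2.2⟩
  have hcρ : ∀ᶠ s in 𝓝 (ρ e), s ∈ ρ.target ∧
      MDifferentiableAt (𝓘(ℝ, EP).prod I) I (Function.uncurry Φ) (ρ.symm s, x) ∧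
      Φ (ρ.symm s) x ∈ ψ.source ∧
      α (Φ (ρ.symm s) x) (mfderiv I I (Φ (ρ.symm s)) x v) = α x v := by
    have hc : ContinuousAt ρ.symm (ρ e) := continuousAt_extChartAt_symm e
    have h1 := hev1.and hinv
    rw [← hρs] at h1
    filter_upwards [hc.eventually h1, extChartAt_target_mem_nhds (I := 𝓘(ℝ, EP)) e] with s hs hs'
    exact ⟨hs', hs.1.1, hs.1.2.1, hs.2⟩
  have hcψ : ∀ᶠ y in 𝓝 (ψ x), y ∈ ψ.target ∧
      MDifferentiableAt (𝓘(ℝ, EP).prod I) I (Function.uncurry Φ) (e, ψ.symm y) := by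
    have hc : ContinuousAt ψ.symm (ψ x) := continuousAt_extChartAt_symm x
    have h1 := hev2
    rw [← hψs] at h1
    filter_upwards [hc.eventually h1, extChartAt_target_mem_nhds (I := I) x] with s hs hs'
    exact ⟨hs', hs.1⟩
  have hid : ∀ᶠ y in 𝓝 (ψ x), Ψ (ρ e, y) = y := by
    filter_upwards [hcψ] with y hy
    simp only [hΨ, hρs, he]
    exact ψ.right_inv hy.1
  have hgen : ∀ y ∈ ψ.target,
      MDifferentiableAt (𝓘(ℝ, EP).prod I) I (Function.uncurry Φ) (e, ψ.symm y) →
      fderiv ℝ (fun s => Ψ (s, y)) (ρ e) η =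
        mfderiv I 𝓘(ℝ, E') ψ (ψ.symm y) (X (ψ.symm y)) := by
    intro y hy hd
    have hdg : MDifferentiableAt 𝓘(ℝ, EP) I (fun g => Φ g (ψ.symm y)) (ρ.symm (ρ e)) := by
      rw [hρs]
      exact MDifferentiableAt.comp (g := Function.uncurry Φ) e hd
        (mdifferentiableAt_id.prodMk mdifferentiableAt_const)
    have hsrc : Φ (ρ.symm (ρ e)) (ψ.symm y) ∈ ψ.source := by
      rw [hρs, he]
      exact ψ.map_target hy
    have h := hasFDerivAt_chart (f := fun g => Φ g (ψ.symm y)) (x₀ := e) (z₀ := x) (y := ρ e)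
      (mem_extChartAt_target e) hsrc hdg
    have h1 : modelDeriv 𝓘(ℝ, EP) 𝓘(ℝ, EP) ρ.symm (ρ e) = .id ℝ EP :=
      mfderiv_extChartAt_symm_self e
    rw [h.fderiv, h1, hX]
    -- The base points agree only propositionally; treating them as variables makes the
    -- identification of their tangent spaces trivial.
    have key : ∀ g : P, g = e → ∀ z : N, z = ψ.symm y →
        (mfderiv I 𝓘(ℝ, E') ψ z : E' →L[ℝ] E')
          ((mfderiv 𝓘(ℝ, EP) I (fun g => Φ g (ψ.symm y)) g : EP →L[ℝ] E') η) =
        (mfderiv I 𝓘(ℝ, E') ψ (ψ.symm y) : E' →L[ℝ] E')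
          ((mfderiv 𝓘(ℝ, EP) I (fun g => Φ g (ψ.symm y)) e : EP →L[ℝ] E') η) := by
      rintro _ rfl _ rfl; rfl
    exact key _ hρs _ ((congrArg (Φ · (ψ.symm y)) hρs).trans (he _))
  have hconst : ∀ᶠ s in 𝓝 (ρ e),
      chartForm I α x (Ψ (s, ψ x)) (fderiv ℝ (fun y => Ψ (s, y)) (ψ x) v) = α x v := by
    filter_upwards [hcρ] with s hs
    obtain ⟨hs1, hs2, hs3, hs4⟩ := hs
    have hdg : MDifferentiableAt I I (Φ (ρ.symm s)) (ψ.symm (ψ x)) := by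
      rw [hψs]
      exact MDifferentiableAt.comp (g := Function.uncurry Φ) x hs2
        (mdifferentiableAt_const.prodMk mdifferentiableAt_id)
    have hsrc : Φ (ρ.symm s) (ψ.symm (ψ x)) ∈ ψ.source := by
      rwa [hψs]
    have h := hasFDerivAt_chart (f := Φ (ρ.symm s)) (x₀ := x) (z₀ := x) (y := ψ x)
      (mem_extChartAt_target x) hsrc hdg
    have hh : fderiv ℝ (fun y => Ψ (s, y)) (ψ x) v = mfderiv I 𝓘(ℝ, E') ψ (Φ (ρ.symm s) x)
        (mfderiv I I (Φ (ρ.symm s)) x v) := by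
      have h1 : modelDeriv 𝓘(ℝ, E') I ψ.symm (ψ x) = .id ℝ E' :=
        mfderiv_extChartAt_symm_self x
      rw [h.fderiv, h1]
      have key : ∀ z : N, z = x →
        (mfderiv I 𝓘(ℝ, E') ψ (Φ (ρ.symm s) z) : E' →L[ℝ] E')
          ((mfderiv I I (Φ (ρ.symm s)) z : E' →L[ℝ] E') v) =
        (mfderiv I 𝓘(ℝ, E') ψ (Φ (ρ.symm s) x) : E' →L[ℝ] E')
          ((mfderiv I I (Φ (ρ.symm s)) x : E' →L[ℝ] E') v) := by
        rintro _ rfl; rfl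
      exact key _ hψs
    have hh' : Ψ (s, ψ x) = ψ (Φ (ρ.symm s) x) := by simp only [hΨ, hψs]
    rw [hh, hh', chartForm_mfderiv α hs3, hs4]
  have main := fderiv_sub_fderiv_of_invariant hsm hid hα hconst η
  have hX0 : fderiv ℝ (fun s => Ψ (s, ψ x)) (ρ e) η = X x := by
    rw [hgen _ (mem_extChartAt_target x) hcψ.self_of_nhds.2, hψs, mfderiv_extChartAt_self]
    rfl
  -- The function α(X) is differentiated, so its coordinate expression is needed on a neighbourhood
  -- and not only at the centre of the chart.
  have hfun : (fun y => chartForm I α x y (fderiv ℝ (fun s => Ψ (s, y)) (ρ e) η)) =ᶠ[𝓝 (ψ x)]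
      fun y => α (ψ.symm y) (X (ψ.symm y)) := by
    filter_upwards [hcψ] with y hy
    rw [hgen y hy.1 hy.2]
    conv_lhs => rw [← ψ.right_inv hy.1]
    rw [ψ.right_inv hy.1]
    have := chartForm_mfderiv α (ψ.map_target hy.1) (X (ψ.symm y))
    rwa [ψ.right_inv hy.1] at this
  rw [hfun.fderiv_eq, hX0] at main
  exact (extDerivForm_apply α x (X x) v).trans main

end Forms

end Nonholonomic

namespace Nonholonomic

/-! ### The canonical forms in the charts of T*Q. -/

section Cotangent

variable {E : Type*} [NormedAddCommGroup E] [NormedSpace ℝ E] [FiniteDimensional ℝ E]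
  {Q : Type*} [TopologicalSpace Q] [ChartedSpace E Q] [IsManifold 𝓘(ℝ, E) ∞ Q]

theorem inCoordinates_trivial (q₀ q : Q) (p : TangentSpace 𝓘(ℝ, E) q →L[ℝ] ℝ) :
    ContinuousLinearMap.inCoordinates E (fun q : Q => TangentSpace 𝓘(ℝ, E) q) ℝ (Bundle.Trivial Q ℝ)
      q₀ q q₀ q p = p.comp ((trivializationAt E (TangentSpace 𝓘(ℝ, E)) q₀).symmL ℝ q) := by
  refine ContinuousLinearMap.ext fun v => ?_
  have h : (trivializationAt ℝ (Bundle.Trivial Q ℝ) q₀).continuousLinearMapAt ℝ q = .id ℝ ℝ :=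
    Bundle.Trivial.continuousLinearMapAt_trivialization ℝ Q ℝ q
  exact DFunLike.congr_fun h _

/-- T*Q is the bundle of homomorphisms from TQ to a trivial line bundle, so only the trivialization
of TQ enters the fibre coordinate. -/
theorem cotangent_extChartAt (p₀ p : CotangentBundle E Q) :
    extChartAt (𝓘(ℝ, E).prod 𝓘(ℝ, E →L[ℝ] ℝ)) p₀ p =
      (chartAt E p₀.1 p.1, p.2.comp
        ((trivializationAt E (TangentSpace 𝓘(ℝ, E)) p₀.1).symmL ℝ p.1)) := by
  have h := hom_chart (𝕜 := ℝ) (F₁ := E) (E₁ := fun q : Q => TangentSpace 𝓘(ℝ, E) q) (F₂ := ℝ)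
    (E₂ := Bundle.Trivial Q ℝ) (HB := E) p₀ p
  rw [inCoordinates_trivial] at h
  exact h

theorem cotangent_mem_source {p₀ p : CotangentBundle E Q} :
    p ∈ (extChartAt (𝓘(ℝ, E).prod 𝓘(ℝ, E →L[ℝ] ℝ)) p₀).source ↔ p.1 ∈ (chartAt E p₀.1).source := by
  rw [extChartAt_source, FiberBundle.chartedSpace_chartAt]
  simp only [mfld_simps]
  exact ⟨fun h => h.1.1, fun h => ⟨⟨h, Set.mem_univ _⟩, h⟩⟩

theorem contMDiff_cotangent_proj : ContMDiff (𝓘(ℝ, E).prod 𝓘(ℝ, E →L[ℝ] ℝ)) 𝓘(ℝ, E) ∞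
    (fun p : CotangentBundle E Q => p.1) := Bundle.contMDiff_proj _

/-- Over the chart domain the trivialization of TQ is the tangent map of the chart, so its fibrewise
inverse undoes that tangent map. -/
theorem symmL_eq_of_modelDeriv {q₀ q : Q} (hq : q ∈ (chartAt E q₀).source)
    (u : TangentSpace 𝓘(ℝ, E) q) :
    (trivializationAt E (TangentSpace 𝓘(ℝ, E)) q₀).symmL ℝ q
      (modelDeriv 𝓘(ℝ, E) 𝓘(ℝ, E) (extChartAt 𝓘(ℝ, E) q₀) q u) = u := by
  have : IsManifold 𝓘(ℝ, E) 1 Q := IsManifold.of_le (n := ∞) (by simp)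
  have h := TangentBundle.continuousLinearMapAt_trivializationAt (I := 𝓘(ℝ, E)) hq
  have h2 : modelDeriv 𝓘(ℝ, E) 𝓘(ℝ, E) (extChartAt 𝓘(ℝ, E) q₀) q u =
    (trivializationAt E (TangentSpace 𝓘(ℝ, E)) q₀).continuousLinearMapAt ℝ q u :=
    (DFunLike.congr_fun h u).symm
  rw [h2]
  exact (trivializationAt E (TangentSpace 𝓘(ℝ, E)) q₀).symmL_continuousLinearMapAt (R := ℝ) hq u

theorem symmL_self (q : Q) (u : TangentSpace 𝓘(ℝ, E) q) :
    (trivializationAt E (TangentSpace 𝓘(ℝ, E)) q).symmL ℝ q u = u := by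
  have : IsManifold 𝓘(ℝ, E) 1 Q := IsManifold.of_le (n := ∞) (by simp)
  have h : modelDeriv 𝓘(ℝ, E) 𝓘(ℝ, E) (extChartAt 𝓘(ℝ, E) q) q = .id ℝ E :=
    mfderiv_extChartAt_self
  have h2 := symmL_eq_of_modelDeriv (mem_chart_source E q) u
  rwa [h] at h2

/-- In the charts of `T*Q`, the canonical 1-form is `(x, p) ↦ ((x', p') ↦ p x')`. -/
theorem chartForm_canonicalOneForm (p₀ : CotangentBundle E Q) {y : E × (E →L[ℝ] ℝ)}
    (hy : y ∈ (extChartAt (𝓘(ℝ, E).prod 𝓘(ℝ, E →L[ℝ] ℝ)) p₀).target) :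
    chartForm (𝓘(ℝ, E).prod 𝓘(ℝ, E →L[ℝ] ℝ)) NHSystem.canonicalOneForm p₀ y =
      y.2.comp (.fst ℝ E (E →L[ℝ] ℝ)) := by
  have : IsManifold 𝓘(ℝ, E) 1 Q := IsManifold.of_le (n := ∞) (by simp)
  have : IsManifold (𝓘(ℝ, E).prod 𝓘(ℝ, E →L[ℝ] ℝ)) 1 (CotangentBundle E Q) :=
    IsManifold.of_le (n := ∞) (by simp)
  set ψ := extChartAt (𝓘(ℝ, E).prod 𝓘(ℝ, E →L[ℝ] ℝ)) p₀ with hψ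
  set p := ψ.symm y with hp
  have hps : p ∈ ψ.source := ψ.map_target hy
  have hq : p.1 ∈ (chartAt E p₀.1).source := cotangent_mem_source.1 hps
  have hyp : y = (chartAt E p₀.1 p.1, p.2.comp
        ((trivializationAt E (TangentSpace 𝓘(ℝ, E)) p₀.1).symmL ℝ p.1)) := by
    rw [← cotangent_extChartAt, ← hψ, hp, ψ.right_inv hy]
  refine ContinuousLinearMap.ext fun v => ?_
  set u : TangentSpace 𝓘(ℝ, E) p.1 :=
    modelDeriv (𝓘(ℝ, E).prod 𝓘(ℝ, E →L[ℝ] ℝ)) 𝓘(ℝ, E) (fun p : CotangentBundle E Q => p.1) p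
      (modelDeriv 𝓘(ℝ, E × (E →L[ℝ] ℝ)) (𝓘(ℝ, E).prod 𝓘(ℝ, E →L[ℝ] ℝ)) ψ.symm y v) with hu
  -- In these charts the bundle projection is the first projection on the whole chart domain, which
  -- determines its derivative at points other than the centre.
  have hu1 : modelDeriv 𝓘(ℝ, E) 𝓘(ℝ, E) (extChartAt 𝓘(ℝ, E) p₀.1) p.1 u = v.1 := by
    have h := hasFDerivAt_chart (I := 𝓘(ℝ, E).prod 𝓘(ℝ, E →L[ℝ] ℝ)) (I₂ := 𝓘(ℝ, E))
      (f := fun p : CotangentBundle E Q => p.1) (x₀ := p₀) (z₀ := p₀.1) hy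
      (by rw [extChartAt_source]; exact hq) (contMDiff_cotangent_proj.mdifferentiableAt (by simp))
    have h2 : HasFDerivAt (fun y => extChartAt 𝓘(ℝ, E) p₀.1 (ψ.symm y).1)
        (.fst ℝ E (E →L[ℝ] ℝ)) y := by
      refine hasFDerivAt_fst.congr_of_eventuallyEq ?_
      filter_upwards [(isOpen_extChartAt_target p₀).mem_nhds hy] with z hz
      have hz2 := cotangent_extChartAt p₀ (ψ.symm z)
      rw [← hψ, ψ.right_inv hz] at hz2
      exact (congrArg Prod.fst hz2).symm
    exact DFunLike.congr_fun (h.unique h2) v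
  have hu2 := symmL_eq_of_modelDeriv hq u
  rw [hu1] at hu2
  change p.2 u = y.2 v.1
  rw [hyp, ← hu2]
  rfl

theorem hasFDerivAt_of_eventuallyEq_clm {A B : Type*} [NormedAddCommGroup A] [NormedSpace ℝ A]
    [NormedAddCommGroup B] [NormedSpace ℝ B] (L : A →L[ℝ] B) {f : A → B} {y : A}
    (h : ∀ᶠ z in 𝓝 y, f z = L z) : HasFDerivAt f L y :=
  L.hasFDerivAt.congr_of_eventuallyEq h

/-- The bilinear map `((x, p), (x', p')) ↦ p x'`, i.e. the coordinate expression of the canonical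
1-form as a function of the base point. -/
noncomputable def pairingCLM (E : Type*) [NormedAddCommGroup E] [NormedSpace ℝ E] :
    (E × (E →L[ℝ] ℝ)) →L[ℝ] (E × (E →L[ℝ] ℝ)) →L[ℝ] ℝ :=
  ((ContinuousLinearMap.compL ℝ (E × (E →L[ℝ] ℝ)) E ℝ).flip (.fst ℝ E (E →L[ℝ] ℝ))).comp
    (.snd ℝ E (E →L[ℝ] ℝ))

-- Near the centre of the chart the representative of Θ_Q depends linearly on the base point, so it
-- is its own derivative.
set_option synthInstance.maxHeartbeats 200000 in
theorem hasFDerivAt_chartForm_canonicalOneForm (p : CotangentBundle E Q) :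
    HasFDerivAt (chartForm (𝓘(ℝ, E).prod 𝓘(ℝ, E →L[ℝ] ℝ)) NHSystem.canonicalOneForm p)
      (pairingCLM E) (extChartAt (𝓘(ℝ, E).prod 𝓘(ℝ, E →L[ℝ] ℝ)) p p) := by
  refine hasFDerivAt_of_eventuallyEq_clm (A := E × (E →L[ℝ] ℝ)) (B := E × (E →L[ℝ] ℝ) →L[ℝ] ℝ)
    (pairingCLM E) ?_
  filter_upwards [extChartAt_target_mem_nhds p] with y hy
  exact chartForm_canonicalOneForm p hy

/-- The canonical 2-form is `((x, p), (x', p')) ↦ p' x - p x'`. -/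
theorem canonicalTwoForm_apply (p : CotangentBundle E Q) (u v : E × (E →L[ℝ] ℝ)) :
    NHSystem.canonicalTwoForm p u v = v.2 u.1 - u.2 v.1 := by
  have : IsManifold (𝓘(ℝ, E).prod 𝓘(ℝ, E →L[ℝ] ℝ)) 1 (CotangentBundle E Q) :=
    IsManifold.of_le (n := ∞) (by simp)
  have h := extDerivForm_apply (I := 𝓘(ℝ, E).prod 𝓘(ℝ, E →L[ℝ] ℝ)) NHSystem.canonicalOneForm p u v
  rw [(hasFDerivAt_chartForm_canonicalOneForm p).fderiv] at h
  have h2 : extDerivForm (𝓘(ℝ, E).prod 𝓘(ℝ, E →L[ℝ] ℝ)) NHSystem.canonicalOneForm p u v =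
    u.2 v.1 - v.2 u.1 := h
  change -(extDerivForm (𝓘(ℝ, E).prod 𝓘(ℝ, E →L[ℝ] ℝ)) NHSystem.canonicalOneForm p u v) = _
  rw [h2]
  ring

theorem modelDeriv_cotangent_proj (p : CotangentBundle E Q) :
    modelDeriv (𝓘(ℝ, E).prod 𝓘(ℝ, E →L[ℝ] ℝ)) 𝓘(ℝ, E) (fun p : CotangentBundle E Q => p.1) p =
      .fst ℝ E (E →L[ℝ] ℝ) := by
  have : IsManifold 𝓘(ℝ, E) 1 Q := IsManifold.of_le (n := ∞) (by simp)
  have : IsManifold (𝓘(ℝ, E).prod 𝓘(ℝ, E →L[ℝ] ℝ)) 1 (CotangentBundle E Q) :=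
    IsManifold.of_le (n := ∞) (by simp)
  rw [modelDeriv_eq_fderiv (contMDiff_cotangent_proj.mdifferentiableAt (by simp))]
  refine HasFDerivAt.fderiv (hasFDerivAt_fst.congr_of_eventuallyEq ?_)
  filter_upwards [extChartAt_target_mem_nhds p] with z hz
  have hz2 := cotangent_extChartAt p ((extChartAt (𝓘(ℝ, E).prod 𝓘(ℝ, E →L[ℝ] ℝ)) p).symm z)
  rw [PartialEquiv.right_inv _ hz] at hz2
  exact (congrArg Prod.fst hz2).symm

end Cotangent

/-! ### Joint smoothness of the cotangent lift. -/

section Lift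

variable {E : Type*} [NormedAddCommGroup E] [NormedSpace ℝ E] [FiniteDimensional ℝ E]
  {Q : Type*} [TopologicalSpace Q] [ChartedSpace E Q] [IsManifold 𝓘(ℝ, E) ∞ Q]
  {EG : Type*} [NormedAddCommGroup EG] [NormedSpace ℝ EG]
  {G : Type*} [TopologicalSpace G] [ChartedSpace EG G] [Group G] [LieGroup 𝓘(ℝ, EG) ∞ G]
  [MulAction G Q]

open NHSystem

/-- In bundle coordinates the fibre part of the lift is the covector composed with the derivative of
q' ↦ g⁻¹q' at gq. The first factor is a coordinate of the covector; the second is the derivative of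
a smooth family of maps at a smoothly moving point. -/
theorem contMDiff_cotangentLift [ContMDiffSMul 𝓘(ℝ, EG) 𝓘(ℝ, E) ∞ G Q] :
    ContMDiff (𝓘(ℝ, EG).prod (𝓘(ℝ, E).prod 𝓘(ℝ, E →L[ℝ] ℝ))) (𝓘(ℝ, E).prod 𝓘(ℝ, E →L[ℝ] ℝ)) ∞
      (fun x : G × CotangentBundle E Q => cotangentLift x.1 x.2) := by
  have : IsManifold 𝓘(ℝ, E) 1 Q := IsManifold.of_le (n := ∞) (by simp)
  have hsm : ContMDiff (𝓘(ℝ, EG).prod 𝓘(ℝ, E)) 𝓘(ℝ, E) ∞ (fun x : G × Q => x.1 • x.2) :=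
    ContMDiffSMul.contMDiff_smul
  have hbase : ContMDiff (𝓘(ℝ, EG).prod (𝓘(ℝ, E).prod 𝓘(ℝ, E →L[ℝ] ℝ))) 𝓘(ℝ, E) ∞
      (fun x : G × CotangentBundle E Q => x.1 • x.2.1) :=
    hsm.comp (contMDiff_fst.prodMk (contMDiff_cotangent_proj.comp contMDiff_snd))
  intro x₀
  refine (contMDiffAt_hom_bundle (F₁ := E) (E₁ := fun q : Q => TangentSpace 𝓘(ℝ, E) q) (F₂ := ℝ)
    (E₂ := Bundle.Trivial Q ℝ) _).2 ⟨hbase x₀, ?_⟩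
  have h1 : ContMDiffAt (𝓘(ℝ, EG).prod (𝓘(ℝ, E).prod 𝓘(ℝ, E →L[ℝ] ℝ))) 𝓘(ℝ, E →L[ℝ] ℝ) ∞
      (fun x : G × CotangentBundle E Q => x.2.2.comp
        ((trivializationAt E (TangentSpace 𝓘(ℝ, E)) x₀.2.1).symmL ℝ x.2.1)) x₀ := by
    have h := ((contMDiffAt_hom_bundle (F₁ := E) (E₁ := fun q : Q => TangentSpace 𝓘(ℝ, E) q) (F₂ := ℝ)
      (E₂ := Bundle.Trivial Q ℝ) (n := ∞) (IB := 𝓘(ℝ, E)) (x₀ := x₀)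
      (IM := 𝓘(ℝ, EG).prod (𝓘(ℝ, E).prod 𝓘(ℝ, E →L[ℝ] ℝ)))
      (fun x : G × CotangentBundle E Q => x.2)).1 contMDiffAt_snd).2
    simp only [inCoordinates_trivial] at h
    exact h
  have h2 := ContMDiffAt.mfderiv (I := 𝓘(ℝ, E)) (I' := 𝓘(ℝ, E)) (x₀ := x₀) (m := ∞) (n := ∞)
    (fun (x : G × CotangentBundle E Q) (q : Q) => x.1⁻¹ • q)
    (fun x : G × CotangentBundle E Q => x.1 • x.2.1)
    ((hsm.comp ((contMDiff_fst.comp contMDiff_fst).inv.prodMk contMDiff_snd)).contMDiffAt)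
    (hbase x₀) (by simp)
  have hfun : (fun x : G × CotangentBundle E Q => x.1⁻¹ • x.1 • x.2.1) = fun x => x.2.1 := by
    funext x
    simp
  rw [hfun] at h2
  refine (h1.clm_comp h2).congr_of_eventuallyEq ?_
  have hq : ∀ᶠ x : G × CotangentBundle E Q in 𝓝 x₀, x.2.1 ∈ (chartAt E x₀.2.1).source :=
    ((contMDiff_cotangent_proj (E := E) (Q := Q)).continuous.comp continuous_snd).continuousAt.eventually_mem
      ((chartAt E x₀.2.1).open_source.mem_nhds (mem_chart_source E _))
  filter_upwards [hq] with x hx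
  rw [inCoordinates_trivial]
  refine ContinuousLinearMap.ext fun v => ?_
  -- The two factors meet over q, where the trivialization of TQ and its inverse cancel.
  exact congrArg x.2.2
    ((trivializationAt E (TangentSpace 𝓘(ℝ, E)) x₀.2.1).symmL_continuousLinearMapAt (R := ℝ) hx _).symm

end Lift
end Nonholonomic

namespace Nonholonomic
namespace NHSystem

variable {E : Type*} [NormedAddCommGroup E] [NormedSpace ℝ E] [FiniteDimensional ℝ E]
  {Q : Type*} [TopologicalSpace Q] [ChartedSpace E Q] [IsManifold 𝓘(ℝ, E) ∞ Q]
  {r : ℕ} (S : NHSystem E Q r)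

/-! ### The inclusion of M in T*Q and its tangent map. -/

section Embedding

theorem mem_extChartAt_source_iff {m m' : S.M} :
    m' ∈ (extChartAt 𝓘(ℝ, E × (Fin r → ℝ)) m).source ↔ S.τ m' ∈ S.coordBase (S.τ m) := by
  rw [extChartAt_source]
  rfl

theorem mem_extChartAt_target_iff {m : S.M} {y : E × (Fin r → ℝ)} :
    y ∈ (extChartAt 𝓘(ℝ, E × (Fin r → ℝ)) m).target ↔ y.1 ∈ (chartAt E (S.τ m)).target ∧
      (chartAt E (S.τ m)).symm y.1 ∈ S.frameSet (S.τ m) := by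
  rw [extChartAt_target]
  simp only [mfld_simps]
  rfl

theorem incl_extChartAt_symm {m : S.M} {y : E × (Fin r → ℝ)}
    (hy : y ∈ (extChartAt 𝓘(ℝ, E × (Fin r → ℝ)) m).target) :
    S.incl ((extChartAt 𝓘(ℝ, E × (Fin r → ℝ)) m).symm y) = S.ofCoord (S.τ m) y :=
  congrArg Subtype.val (dif_pos (S.mem_extChartAt_target_iff.1 hy).2)

theorem τ_extChartAt_symm {m : S.M} {y : E × (Fin r → ℝ)}
    (hy : y ∈ (extChartAt 𝓘(ℝ, E × (Fin r → ℝ)) m).target) :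
    S.τ ((extChartAt 𝓘(ℝ, E × (Fin r → ℝ)) m).symm y) = (chartAt E (S.τ m)).symm y.1 :=
  congrArg TotalSpace.proj (S.incl_extChartAt_symm hy)

theorem contMDiff_incl :
    ContMDiff 𝓘(ℝ, E × (Fin r → ℝ)) (𝓘(ℝ, E).prod 𝓘(ℝ, E →L[ℝ] ℝ)) ∞ S.incl := by
  intro m
  have h1 : ContMDiffAt 𝓘(ℝ, E × (Fin r → ℝ)) 𝓘(ℝ, E × (Fin r → ℝ)) ∞
      (extChartAt 𝓘(ℝ, E × (Fin r → ℝ)) m) m := contMDiffAt_extChartAt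
  have h2 : ContMDiffAt 𝓘(ℝ, E × (Fin r → ℝ)) (𝓘(ℝ, E).prod 𝓘(ℝ, E →L[ℝ] ℝ)) ∞
      (S.ofCoord (S.τ m)) (extChartAt 𝓘(ℝ, E × (Fin r → ℝ)) m m) := by
    refine (S.contMDiffOn_ofCoord (S.τ m)).contMDiffAt ?_
    filter_upwards [extChartAt_target_mem_nhds (I := 𝓘(ℝ, E × (Fin r → ℝ))) m] with y hy
    exact S.mem_extChartAt_target_iff.1 hy
  refine (h2.comp m h1).congr_of_eventuallyEq ?_
  filter_upwards [extChartAt_source_mem_nhds (I := 𝓘(ℝ, E × (Fin r → ℝ))) m] with m' hm'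
  exact (S.ofCoord_toCoord (S.τ m) m'.2 (S.mem_extChartAt_source_iff.1 hm')).symm

theorem contMDiff_τ : ContMDiff 𝓘(ℝ, E × (Fin r → ℝ)) 𝓘(ℝ, E) ∞ S.τ :=
  contMDiff_cotangent_proj.comp S.contMDiff_incl

/-- The charts of M are restrictions of `toCoord`, which is smooth on an open subset of T*Q.
Smoothness of a map into M can thus be tested after including M in T*Q. -/
theorem contMDiffAt_of_incl {EX : Type*} [NormedAddCommGroup EX] [NormedSpace ℝ EX] {HX : Type*}
    [TopologicalSpace HX] {IX : ModelWithCorners ℝ EX HX} {X : Type*} [TopologicalSpace X]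
    [ChartedSpace HX X] {f : X → S.M} {x : X}
    (hf : ContMDiffAt IX (𝓘(ℝ, E).prod 𝓘(ℝ, E →L[ℝ] ℝ)) ∞ (fun x => S.incl (f x)) x) :
    ContMDiffAt IX 𝓘(ℝ, E × (Fin r → ℝ)) ∞ f x := by
  rw [contMDiffAt_iff_target]
  refine ⟨Topology.IsInducing.subtypeVal.continuousAt_iff.2 hf.continuousAt, ?_⟩
  have h : ContMDiffAt (𝓘(ℝ, E).prod 𝓘(ℝ, E →L[ℝ] ℝ)) 𝓘(ℝ, E × (Fin r → ℝ)) ∞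
      (S.toCoord (S.τ (f x))) (S.incl (f x)) := by
    refine (S.contMDiffOn_toCoord _).contMDiffAt ?_
    exact ((S.isOpen_coordBase _).preimage contMDiff_cotangent_proj.continuous).mem_nhds
      ⟨mem_chart_source E _, S.mem_frameSet _⟩
  exact ContMDiffAt.comp (f := fun x => S.incl (f x)) x h hf

/-- The chart of M at `m` is built over the preferred chart of Q at `τ m`, so τ is the first
projection in coordinates. -/
theorem modelDeriv_τ (m : S.M) :
    modelDeriv 𝓘(ℝ, E × (Fin r → ℝ)) 𝓘(ℝ, E) S.τ m = .fst ℝ E (Fin r → ℝ) := by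
  have : IsManifold 𝓘(ℝ, E) 1 Q := IsManifold.of_le (n := ∞) (by simp)
  have : IsManifold 𝓘(ℝ, E × (Fin r → ℝ)) 1 S.M := IsManifold.of_le (n := ∞) (by simp)
  rw [modelDeriv_eq_fderiv (S.contMDiff_τ.mdifferentiableAt (by simp))]
  refine HasFDerivAt.fderiv (hasFDerivAt_fst.congr_of_eventuallyEq ?_)
  filter_upwards [extChartAt_target_mem_nhds (I := 𝓘(ℝ, E × (Fin r → ℝ))) m] with y hy
  rw [S.τ_extChartAt_symm hy]
  exact (chartAt E (S.τ m)).right_inv (S.mem_extChartAt_target_iff.1 hy).1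

/-- The tangent map of the inclusion `M → T*Q`, as a map of the model spaces. -/
noncomputable def inclDeriv (m : S.M) : E × (Fin r → ℝ) →L[ℝ] E × (E →L[ℝ] ℝ) :=
  modelDeriv 𝓘(ℝ, E × (Fin r → ℝ)) (𝓘(ℝ, E).prod 𝓘(ℝ, E →L[ℝ] ℝ)) S.incl m

theorem inclDeriv_fst (m : S.M) (X : E × (Fin r → ℝ)) : (S.inclDeriv m X).1 = X.1 := by
  have h := mfderiv_comp_apply (I := 𝓘(ℝ, E × (Fin r → ℝ))) (I' := 𝓘(ℝ, E).prod 𝓘(ℝ, E →L[ℝ] ℝ))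
    (I'' := 𝓘(ℝ, E)) (f := S.incl) (g := fun p : CotangentBundle E Q => p.1) m
    (contMDiff_cotangent_proj.mdifferentiableAt (by simp))
    (S.contMDiff_incl.mdifferentiableAt (by simp)) X
  have h1 := DFunLike.congr_fun (S.modelDeriv_τ m) X
  have h2 := DFunLike.congr_fun (modelDeriv_cotangent_proj (S.incl m)) (S.inclDeriv m X)
  exact (h2.symm.trans h.symm).trans h1

/-- The vector of `D_q` with quasi-momenta `w`. -/
noncomputable def velocity (q : Q) : (Fin r → ℝ) →ₗ[ℝ] TangentSpace 𝓘(ℝ, E) q :=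
  (Fintype.linearCombination ℝ (fun a => S.frame q a q)).comp (S.gram q q).inverse.toLinearMap

theorem velocity_mem (q : Q) (w : Fin r → ℝ) : S.velocity q w ∈ S.D q := by
  rw [← S.span_frame q (S.mem_frameSet q), Submodule.mem_span_range_iff_exists_fun]
  exact ⟨_, rfl⟩

theorem velocity_injective (q : Q) : Function.Injective (S.velocity q) := by
  obtain ⟨e, he⟩ := S.exists_gram_equiv q (S.mem_frameSet q)
  have hl := S.linearIndependent_frame q (S.mem_frameSet q)
  rw [linearIndependent_iff_injective_fintypeLinearCombination] at hl
  intro w w' h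
  have h2 := hl h
  simp only [← he, ContinuousLinearMap.inverse_equiv] at h2
  exact e.symm.injective h2

theorem exists_velocity_eq {q : Q} {v : TangentSpace 𝓘(ℝ, E) q} (hv : v ∈ S.D q) :
    ∃ w, S.velocity q w = v := by
  obtain ⟨e, he⟩ := S.exists_gram_equiv q (S.mem_frameSet q)
  rw [← S.span_frame q (S.mem_frameSet q), Submodule.mem_span_range_iff_exists_fun] at hv
  obtain ⟨c, rfl⟩ := hv
  refine ⟨e c, ?_⟩
  change Fintype.linearCombination ℝ (fun a => S.frame q a q) ((S.gram q q).inverse (e c)) = _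
  rw [← he, ContinuousLinearMap.inverse_equiv]
  simp [Fintype.linearCombination_apply]

theorem ofCoord_chartAt (q : Q) (w : Fin r → ℝ) :
    S.ofCoord q (chartAt E q q, w) = ⟨q, S.kinetic.inner q (S.velocity q w)⟩ := by
  have h1 : (chartAt E q).symm (chartAt E q q) = q := (chartAt E q).left_inv (mem_chart_source E q)
  unfold ofCoord
  simp only
  rw [h1]
  rfl

theorem hasDerivAt_prodMk_add_smul {A B : Type*} [NormedAddCommGroup A] [NormedSpace ℝ A]
    [NormedAddCommGroup B] [NormedSpace ℝ B] (c : A) (a b : B) :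
    HasDerivAt (fun t : ℝ => (c, a + t • b)) (0, b) 0 := by
  refine (hasDerivAt_const _ _).prodMk ?_
  simpa using ((hasDerivAt_id (0 : ℝ)).smul_const b).const_add a

/-- The tangent vectors to the fibres of `M` are the covectors `κ (v, ·)`, `v ∈ D`. -/
theorem inclDeriv_vertical (m : S.M) (w : Fin r → ℝ) :
    S.inclDeriv m (0, w) = (0, S.kinetic.inner (S.τ m) (S.velocity (S.τ m) w)) := by
  have : IsManifold (𝓘(ℝ, E).prod 𝓘(ℝ, E →L[ℝ] ℝ)) 1 (CotangentBundle E Q) :=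
    IsManifold.of_le (n := ∞) (by simp)
  have : IsManifold 𝓘(ℝ, E × (Fin r → ℝ)) 1 S.M := IsManifold.of_le (n := ∞) (by simp)
  have hd : MDifferentiableAt 𝓘(ℝ, E × (Fin r → ℝ)) (𝓘(ℝ, E).prod 𝓘(ℝ, E →L[ℝ] ℝ)) S.incl m :=
    S.contMDiff_incl.mdifferentiableAt (by simp)
  set q := S.τ m with hq
  set y₀ := extChartAt 𝓘(ℝ, E × (Fin r → ℝ)) m m with hy₀
  set Ψ : E × (Fin r → ℝ) → E × (E →L[ℝ] ℝ) := fun y =>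
    extChartAt (𝓘(ℝ, E).prod 𝓘(ℝ, E →L[ℝ] ℝ)) (S.incl m)
      (S.incl ((extChartAt 𝓘(ℝ, E × (Fin r → ℝ)) m).symm y)) with hΨ
  have hΨd : HasFDerivAt Ψ (S.inclDeriv m) y₀ := by
    have h := modelDeriv_eq_fderiv hd
    rw [inclDeriv, h]
    refine DifferentiableAt.hasFDerivAt ?_
    have h3 := hasFDerivAt_chart (z₀ := S.incl m) (f := S.incl) (mem_extChartAt_target (I := 𝓘(ℝ, E × (Fin r → ℝ))) m)
      (I := 𝓘(ℝ, E × (Fin r → ℝ))) (I₂ := 𝓘(ℝ, E).prod 𝓘(ℝ, E →L[ℝ] ℝ))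
      (by rw [extChartAt_to_inv]; exact mem_extChartAt_source _) (by rwa [extChartAt_to_inv])
    exact h3.differentiableAt
  -- Along a vertical line the base point is constant and the velocity is linear in the
  -- quasi-momenta, so the image curve is affine and its derivative can be read off.
  have hcurve : ∀ t : ℝ, Ψ (y₀ + t • ((0, w) : E × (Fin r → ℝ))) =
      (chartAt E q q, (S.kinetic.inner q (S.velocity q y₀.2) : E →L[ℝ] ℝ) +
        t • (S.kinetic.inner q (S.velocity q w) : E →L[ℝ] ℝ)) := by
    intro t
    have h1 : y₀ + t • ((0, w) : E × (Fin r → ℝ)) = (chartAt E q q, y₀.2 + t • w) := by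
      refine Prod.ext ?_ rfl
      change chartAt E q q + t • (0 : E) = _
      simp
    have h2 : (chartAt E q q, y₀.2 + t • w) ∈ (extChartAt 𝓘(ℝ, E × (Fin r → ℝ)) m).target := by
      rw [mem_extChartAt_target_iff]
      refine ⟨mem_chart_target E q, ?_⟩
      change (chartAt E q).symm (chartAt E q q) ∈ S.frameSet q
      rw [(chartAt E q).left_inv (mem_chart_source E q)]
      exact S.mem_frameSet q
    rw [h1, hΨ]
    simp only
    rw [S.incl_extChartAt_symm h2, S.ofCoord_chartAt, cotangent_extChartAt]
    refine Prod.ext rfl (ContinuousLinearMap.ext fun u => ?_)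
    change S.kinetic.inner q (S.velocity q (y₀.2 + t • w))
      ((trivializationAt E (TangentSpace 𝓘(ℝ, E)) q).symmL ℝ q u) = _
    rw [symmL_self q u, map_add, map_smul, map_add, map_smul]
    rfl
  have hline : HasDerivAt (fun t : ℝ => y₀ + t • ((0, w) : E × (Fin r → ℝ))) (0, w) 0 := by
    simpa using ((hasDerivAt_id (0 : ℝ)).smul_const ((0, w) : E × (Fin r → ℝ))).const_add y₀
  have hΨd' : HasFDerivAt Ψ (S.inclDeriv m) (y₀ + (0 : ℝ) • ((0, w) : E × (Fin r → ℝ))) := by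
    rwa [zero_smul, add_zero]
  have hc1 := hΨd'.comp_hasDerivAt 0 hline
  have hc2 : HasDerivAt (fun t : ℝ => Ψ (y₀ + t • ((0, w) : E × (Fin r → ℝ))))
      (0, (S.kinetic.inner q (S.velocity q w) : E →L[ℝ] ℝ)) 0 := by
    rw [funext hcurve]
    exact hasDerivAt_prodMk_add_smul (A := E) (B := E →L[ℝ] ℝ) (chartAt E q q) _ _
  exact hc1.unique hc2

end Embedding

/-! ### Nondegeneracy of Ω_M on C. -/

section Nondegenerate

theorem mem_C_iff {m : S.M} {X : E × (Fin r → ℝ)} : X ∈ S.C m ↔ X.1 ∈ S.D (S.τ m) := by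
  have h : modelDeriv 𝓘(ℝ, E × (Fin r → ℝ)) 𝓘(ℝ, E) S.τ m X = X.1 :=
    DFunLike.congr_fun (S.modelDeriv_τ m) X
  rw [← h]
  rfl

theorem ΩM_apply (m : S.M) (X Y : E × (Fin r → ℝ)) :
    S.ΩM m X Y = (S.inclDeriv m Y).2 X.1 - (S.inclDeriv m X).2 Y.1 := by
  rw [← S.inclDeriv_fst m X, ← S.inclDeriv_fst m Y]
  exact canonicalTwoForm_apply (S.incl m) (S.inclDeriv m X) (S.inclDeriv m Y)

/-- Vertical vectors represent all covectors κ(v, ·) with v in D. Pairing X with the one belonging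
to its own horizontal part gives κ(X₁, X₁) = 0. Then X is itself vertical, and pairing it with its
own velocity vector gives zero again, up to sign. -/
theorem eq_zero_of_ΩM {m : S.M} {X : E × (Fin r → ℝ)} (hX : X ∈ S.C m)
    (h : ∀ Y : E × (Fin r → ℝ), Y ∈ S.C m → S.ΩM m X Y = 0) : X = 0 := by
  have hpos : ∀ v : TangentSpace 𝓘(ℝ, E) (S.τ m), S.kinetic.inner (S.τ m) v v = 0 → v = 0 := by
    intro v hv
    by_contra hne
    exact (S.kinetic.pos _ v hne).ne' hv
  have h1 : X.1 = 0 := by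
    obtain ⟨w, hw⟩ := S.exists_velocity_eq (S.mem_C_iff.1 hX)
    have h2 := h (0, w) (S.mem_C_iff.2 (zero_mem _))
    rw [ΩM_apply, inclDeriv_vertical, hw] at h2
    refine hpos X.1 ?_
    simpa using! h2
  obtain ⟨x, w⟩ := X
  obtain rfl : x = 0 := h1
  have h2 := h (S.velocity (S.τ m) w, 0) (S.mem_C_iff.2 (S.velocity_mem _ _))
  rw [ΩM_apply, inclDeriv_vertical] at h2
  have h3 : S.velocity (S.τ m) w = 0 := by
    refine hpos _ ?_
    simpa using! h2
  rw [S.velocity_injective _ (h3.trans (map_zero _).symm)]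
  rfl

/-- `Ω_M` is nondegenerate on the distribution `C`. -/
theorem existsUnique_ΩM (m : S.M) (α : S.TM m →ₗ[ℝ] ℝ) :
    ∃! X : S.TM m, X ∈ S.C m ∧ ∀ Y ∈ S.C m, S.ΩM m X Y = α Y := by
  have : FiniteDimensional ℝ (S.TM m) := inferInstanceAs (FiniteDimensional ℝ (E × (Fin r → ℝ)))
  let B : S.C m →ₗ[ℝ] Module.Dual ℝ (S.C m) := (S.ΩM m).compl₁₂ (S.C m).subtype (S.C m).subtype
  have hB : Function.Injective B := by
    rw [← LinearMap.ker_eq_bot, LinearMap.ker_eq_bot']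
    intro X hX
    refine Subtype.ext (S.eq_zero_of_ΩM X.2 fun Y hY => ?_)
    exact DFunLike.congr_fun hX (⟨Y, hY⟩ : S.C m)
  -- `C m` and its dual have the same finite dimension, so injectivity already gives existence.
  have hB' : Function.Surjective B :=
    (LinearMap.injective_iff_surjective_of_finrank_eq_finrank
      Subspace.dual_finrank_eq.symm).1 hB
  obtain ⟨X, hX⟩ := hB' (α.comp (S.C m).subtype)
  refine ⟨X, ⟨X.2, fun Y hY => DFunLike.congr_fun hX (⟨Y, hY⟩ : S.C m)⟩, ?_⟩
  rintro X' ⟨hX', h⟩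
  have h2 : B ⟨X', hX'⟩ = B X := by
    rw [hX]
    exact LinearMap.ext fun Y => h Y Y.2
  exact congrArg Subtype.val (hB h2)

/-- By uniqueness it is enough to exhibit a solution; the sign in the definition of π_nh^♯ is moved
to the right-hand side. -/
theorem piSharp_eq {α : ∀ m : S.M, S.TM m →ₗ[ℝ] ℝ} {m : S.M} {X : S.TM m} (hX : X ∈ S.C m)
    (h : ∀ Y ∈ S.C m, S.ΩM m X Y = -α m Y) : S.piSharp α m = X := by
  have hu := S.existsUnique_ΩM m (α m)
  rw [piSharp, dif_pos hu, neg_eq_iff_eq_neg]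
  refine hu.unique hu.choose_spec.1 ⟨neg_mem hX, fun Y hY => ?_⟩
  rw [map_neg, LinearMap.neg_apply, h Y hY, neg_neg]

end Nondegenerate
end NHSystem
end Nonholonomic

namespace Nonholonomic
namespace NHSystem

variable {E : Type*} [NormedAddCommGroup E] [NormedSpace ℝ E] [FiniteDimensional ℝ E]
  {Q : Type*} [TopologicalSpace Q] [ChartedSpace E Q] [IsManifold 𝓘(ℝ, E) ∞ Q]
  {r : ℕ} {S : NHSystem E Q r}
  {EG : Type*} [NormedAddCommGroup EG] [NormedSpace ℝ EG]
  {G : Type*} [TopologicalSpace G] [ChartedSpace EG G] [Group G] [LieGroup 𝓘(ℝ, EG) ∞ G]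
  [MulAction G Q]

/-! ### The action on M and its momentum map. -/

section Lifts

theorem cotangentLift_one (p : CotangentBundle E Q) : cotangentLift (1 : G) p = p := by
  obtain ⟨q, p⟩ := p
  have key : ∀ (q' : Q) (L : E →L[ℝ] E), q' = q → L = .id ℝ E →
      (⟨q', (p : E →L[ℝ] ℝ).comp L⟩ : CotangentBundle E Q) = ⟨q, p⟩ := by
    rintro _ _ rfl rfl
    rfl
  have hid : (fun x : Q => (1 : G)⁻¹ • x) = id := by
    funext x
    simp
  have hL : modelDeriv 𝓘(ℝ, E) 𝓘(ℝ, E) (fun x : Q => (1 : G)⁻¹ • x) ((1 : G) • q) = .id ℝ E := by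
    rw [hid]
    exact mfderiv_id
  exact key _ _ (one_smul G q) hL

namespace IsSymmetry
variable (h : S.IsSymmetry EG G)

theorem act_one (m : S.M) : h.act 1 m = m := Subtype.ext (cotangentLift_one m.1)

theorem contMDiff_act : ContMDiff (𝓘(ℝ, EG).prod 𝓘(ℝ, E × (Fin r → ℝ))) 𝓘(ℝ, E × (Fin r → ℝ)) ∞
    (fun x : G × S.M => h.act x.1 x.2) := by
  have := h.contMDiffSMul
  intro x
  refine S.contMDiffAt_of_incl ?_
  exact ((contMDiff_cotangentLift (EG := EG) (G := G)).comp
    (contMDiff_fst.prodMk (S.contMDiff_incl.comp contMDiff_snd))).contMDiffAt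

theorem contMDiff_act_left (m : S.M) :
    ContMDiff 𝓘(ℝ, EG) 𝓘(ℝ, E × (Fin r → ℝ)) ∞ (fun g : G => h.act g m) :=
  h.contMDiff_act.comp (contMDiff_id.prodMk contMDiff_const)

theorem contMDiff_act_right (g : G) :
    ContMDiff 𝓘(ℝ, E × (Fin r → ℝ)) 𝓘(ℝ, E × (Fin r → ℝ)) ∞ (fun m : S.M => h.act g m) :=
  h.contMDiff_act.comp (contMDiff_const.prodMk contMDiff_id)

/-- This is the derivative at the identity of the equivariance τ(g m) = g τ(m). -/
theorem genM_fst (m : S.M) (η : EG) :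
    (h.genM m η : E × (Fin r → ℝ)).1 = genQ (EG := EG) (G := G) (S.τ m) η := by
  have h1 := mfderiv_comp_apply (I := 𝓘(ℝ, EG)) (I' := 𝓘(ℝ, E × (Fin r → ℝ)))
    (I'' := 𝓘(ℝ, E)) (f := fun g : G => h.act g m) (g := S.τ) 1
    (S.contMDiff_τ.mdifferentiableAt (by simp))
    ((h.contMDiff_act_left m).mdifferentiableAt (by simp)) η
  have h2 := DFunLike.congr_fun (S.modelDeriv_τ (h.act 1 m)) (h.genM m η)
  exact (h1.trans h2).symm

theorem inclDeriv_genM (m : S.M) (η : EG) :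
    S.inclDeriv m (h.genM m η) = modelDeriv 𝓘(ℝ, EG) (𝓘(ℝ, E).prod 𝓘(ℝ, E →L[ℝ] ℝ))
      (fun g : G => cotangentLift g (S.incl m)) 1 η := by
  have h1 := mfderiv_comp_apply (I := 𝓘(ℝ, EG)) (I' := 𝓘(ℝ, E × (Fin r → ℝ)))
    (I'' := 𝓘(ℝ, E).prod 𝓘(ℝ, E →L[ℝ] ℝ)) (f := fun g : G => h.act g m) (g := S.incl) 1
    (S.contMDiff_incl.mdifferentiableAt (by simp))
    ((h.contMDiff_act_left m).mdifferentiableAt (by simp)) η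
  have h2 : S.inclDeriv (h.act 1 m) (h.genM m η) = S.inclDeriv m (h.genM m η) := by
    rw [h.act_one]
  exact h2.symm.trans h1.symm

/-- C is the preimage of D under Tτ; τ is equivariant and D is invariant. -/
theorem act_mem_C {m : S.M} {Y : E × (Fin r → ℝ)} (hY : Y ∈ S.C m) (g : G) :
    mfderiv 𝓘(ℝ, E × (Fin r → ℝ)) 𝓘(ℝ, E × (Fin r → ℝ)) (h.act g) m Y ∈ S.C (h.act g m) := by
  have h1 := mfderiv_comp_apply (I := 𝓘(ℝ, E × (Fin r → ℝ))) (I' := 𝓘(ℝ, E × (Fin r → ℝ)))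
    (I'' := 𝓘(ℝ, E)) (f := h.act g) (g := S.τ) m
    (S.contMDiff_τ.mdifferentiableAt (by simp))
    ((h.contMDiff_act_right g).mdifferentiableAt (by simp)) Y
  have h2 := mfderiv_comp_apply (I := 𝓘(ℝ, E × (Fin r → ℝ))) (I' := 𝓘(ℝ, E))
    (I'' := 𝓘(ℝ, E)) (f := S.τ) (g := fun q : Q => g • q) m
    ((h.contMDiff_smul_left g).mdifferentiableAt (by simp))
    (S.contMDiff_τ.mdifferentiableAt (by simp)) Y
  have h3 := h.constraint_invariant g (S.τ m) _ hY
  have h4 := h2.symm.trans h1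
  change mfderiv 𝓘(ℝ, E × (Fin r → ℝ)) 𝓘(ℝ, E) S.τ (h.act g m) _ ∈ S.D (g • S.τ m)
  exact h4 ▸ h3

/-- The lift covers q ↦ gq, so the projected vector is moved by Tg, and this cancels the T(g⁻¹) with
which the covector is composed. -/
theorem canonicalOneForm_cotangentLift (h : S.IsSymmetry EG G) (g : G) (p : CotangentBundle E Q) (v : E × (E →L[ℝ] ℝ)) :
    canonicalOneForm (cotangentLift g p)
      (mfderiv (𝓘(ℝ, E).prod 𝓘(ℝ, E →L[ℝ] ℝ)) (𝓘(ℝ, E).prod 𝓘(ℝ, E →L[ℝ] ℝ))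
        (cotangentLift g) p v) = canonicalOneForm p v := by
  have := h.contMDiffSMul
  have hc : ContMDiff (𝓘(ℝ, E).prod 𝓘(ℝ, E →L[ℝ] ℝ)) (𝓘(ℝ, E).prod 𝓘(ℝ, E →L[ℝ] ℝ)) ∞
      (fun p : CotangentBundle E Q => cotangentLift g p) :=
    (contMDiff_cotangentLift (EG := EG) (G := G)).comp (contMDiff_const.prodMk contMDiff_id)
  have h1 := mfderiv_comp_apply (I := 𝓘(ℝ, E).prod 𝓘(ℝ, E →L[ℝ] ℝ))
    (I' := 𝓘(ℝ, E).prod 𝓘(ℝ, E →L[ℝ] ℝ)) (I'' := 𝓘(ℝ, E)) (f := cotangentLift g)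
    (g := fun p : CotangentBundle E Q => p.1) p
    (contMDiff_cotangent_proj.mdifferentiableAt (by simp))
    (hc.mdifferentiableAt (by simp)) v
  have h2 := mfderiv_comp_apply (I := 𝓘(ℝ, E).prod 𝓘(ℝ, E →L[ℝ] ℝ)) (I' := 𝓘(ℝ, E))
    (I'' := 𝓘(ℝ, E)) (f := fun p : CotangentBundle E Q => p.1) (g := fun q : Q => g • q) p
    ((h.contMDiff_smul_left g).mdifferentiableAt (by simp))
    (contMDiff_cotangent_proj.mdifferentiableAt (by simp)) v
  set u : E := mfderiv (𝓘(ℝ, E).prod 𝓘(ℝ, E →L[ℝ] ℝ)) 𝓘(ℝ, E)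
    (fun p : CotangentBundle E Q => p.1) p v with hu
  have h3 := mfderiv_comp_apply (I := 𝓘(ℝ, E)) (I' := 𝓘(ℝ, E))
    (I'' := 𝓘(ℝ, E)) (f := fun q : Q => g • q) (g := fun q : Q => g⁻¹ • q) p.1
    ((h.contMDiff_smul_left g⁻¹).mdifferentiableAt (by simp))
    ((h.contMDiff_smul_left g).mdifferentiableAt (by simp)) u
  have hid : (fun q : Q => g⁻¹ • q) ∘ (fun q : Q => g • q) = id := by
    funext x
    simp
  rw [hid, mfderiv_id] at h3
  have h4 : modelDeriv 𝓘(ℝ, E) 𝓘(ℝ, E) (fun q : Q => g⁻¹ • q) (g • p.1)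
      (modelDeriv (𝓘(ℝ, E).prod 𝓘(ℝ, E →L[ℝ] ℝ)) 𝓘(ℝ, E)
        (fun p : CotangentBundle E Q => p.1) (cotangentLift g p)
        (modelDeriv (𝓘(ℝ, E).prod 𝓘(ℝ, E →L[ℝ] ℝ)) (𝓘(ℝ, E).prod 𝓘(ℝ, E →L[ℝ] ℝ))
        (cotangentLift g) p v)) = u :=
    (congrArg (modelDeriv 𝓘(ℝ, E) 𝓘(ℝ, E) (fun q : Q => g⁻¹ • q) (g • p.1))
      (h1.symm.trans h2)).trans h3.symm
  exact congrArg (p.2 : E →L[ℝ] ℝ) h4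

theorem canonicalOneForm_generator (h : S.IsSymmetry EG G) (p : CotangentBundle E Q) (η : EG) :
    canonicalOneForm p (modelDeriv 𝓘(ℝ, EG) (𝓘(ℝ, E).prod 𝓘(ℝ, E →L[ℝ] ℝ))
      (fun g : G => cotangentLift g p) 1 η) = momentumQ EG G p η := by
  have := h.contMDiffSMul
  have hc : ContMDiff 𝓘(ℝ, EG) (𝓘(ℝ, E).prod 𝓘(ℝ, E →L[ℝ] ℝ)) ∞
      (fun g : G => cotangentLift g p) :=
    (contMDiff_cotangentLift (EG := EG) (G := G)).comp (contMDiff_id.prodMk contMDiff_const)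
  have h1 := mfderiv_comp_apply (I := 𝓘(ℝ, EG))
    (I' := 𝓘(ℝ, E).prod 𝓘(ℝ, E →L[ℝ] ℝ)) (I'' := 𝓘(ℝ, E)) (f := fun g : G => cotangentLift g p)
    (g := fun p : CotangentBundle E Q => p.1) 1
    (contMDiff_cotangent_proj.mdifferentiableAt (by simp))
    (hc.mdifferentiableAt (by simp)) η
  have h2 : modelDeriv (𝓘(ℝ, E).prod 𝓘(ℝ, E →L[ℝ] ℝ)) 𝓘(ℝ, E)
      (fun p : CotangentBundle E Q => p.1) (cotangentLift (1 : G) p) =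
      modelDeriv (𝓘(ℝ, E).prod 𝓘(ℝ, E →L[ℝ] ℝ)) 𝓘(ℝ, E) (fun p : CotangentBundle E Q => p.1) p := by
    rw [cotangentLift_one]
  have h3 := (h1.trans (DFunLike.congr_fun h2 _)).symm
  exact congrArg (p.2 : E →L[ℝ] ℝ) h3

/-- This identifies J^nh with the restriction of 𝓙 to 𝔤_S. -/
theorem ΘM_genM (m : S.M) (η : EG) : S.ΘM m (h.genM m η) = S.momentumM EG G m η := by
  have h1 := h.canonicalOneForm_generator (S.incl m) η
  rw [← h.inclDeriv_genM] at h1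
  exact h1

end IsSymmetry

/-- The generator is the partial derivative in g, at g = 1, of the jointly smooth action map, and
hence depends smoothly on q. -/
theorem contMDiff_genQ [ContMDiffSMul 𝓘(ℝ, EG) 𝓘(ℝ, E) ∞ G Q] (η : EG) :
    ContMDiff 𝓘(ℝ, E) (𝓘(ℝ, E).prod 𝓘(ℝ, E)) ∞
      (fun q : Q => (⟨q, genQ (EG := EG) (G := G) q η⟩ : TangentBundle 𝓘(ℝ, E) Q)) := by
  have : IsManifold 𝓘(ℝ, E) 1 Q := IsManifold.of_le (n := ∞) (by simp)
  have hG : IsManifold 𝓘(ℝ, EG) ∞ G := ContMDiffMul.toIsManifold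
  have : IsManifold 𝓘(ℝ, EG) 1 G := IsManifold.of_le (n := ∞) (by simp)
  have hsm : ContMDiff (𝓘(ℝ, EG).prod 𝓘(ℝ, E)) 𝓘(ℝ, E) ∞ (fun x : G × Q => x.1 • x.2) :=
    ContMDiffSMul.contMDiff_smul
  intro q₀
  refine contMDiffAt_totalSpace.2 ⟨contMDiffAt_id, ?_⟩
  have h2 := ContMDiffAt.mfderiv (I := 𝓘(ℝ, EG)) (I' := 𝓘(ℝ, E)) (x₀ := q₀) (m := ∞) (n := ∞)
    (J := 𝓘(ℝ, E)) (fun (q : Q) (g : G) => g • q) (fun _ : Q => (1 : G))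
    ((hsm.comp (contMDiff_snd.prodMk contMDiff_fst)).contMDiffAt)
    contMDiffAt_const (by simp)
  have hfun : (fun q : Q => (1 : G) • q) = fun q => q := by
    funext q
    simp
  rw [hfun] at h2
  have h3 := h2.clm_apply (contMDiffAt_const (c := η))
  refine h3.congr_of_eventuallyEq ?_
  filter_upwards [(chartAt E q₀).open_source.mem_nhds (mem_chart_source E q₀)] with q hq
  have h4 : (trivializationAt EG (TangentSpace 𝓘(ℝ, EG)) (1 : G)).symmL ℝ (1 : G) η = η := by
    have h5 := TangentBundle.continuousLinearMapAt_trivializationAt (I := 𝓘(ℝ, EG))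
      (mem_chart_source EG (1 : G))
    rw [mfderiv_extChartAt_self] at h5
    have h6 := (trivializationAt EG (TangentSpace 𝓘(ℝ, EG)) (1 : G)).symmL_continuousLinearMapAt
      (R := ℝ) (mem_baseSet_trivializationAt EG (TangentSpace 𝓘(ℝ, EG)) (1 : G)) η
    rw [h5] at h6
    exact h6
  have h5 : ∀ v : TangentSpace 𝓘(ℝ, E) q,
      (trivializationAt E (TangentSpace 𝓘(ℝ, E)) q₀ ⟨q, v⟩).2 =
        (trivializationAt E (TangentSpace 𝓘(ℝ, E)) q₀).continuousLinearMapAt ℝ q v := fun v =>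
    (congrFun ((trivializationAt E (TangentSpace 𝓘(ℝ, E)) q₀).coe_linearMapAt_of_mem (R := ℝ) hq) v).symm
  change (trivializationAt E (TangentSpace 𝓘(ℝ, E)) q₀ ⟨q, _⟩).2 =
    (trivializationAt E (TangentSpace 𝓘(ℝ, E)) q₀).continuousLinearMapAt ℝ q
      (modelDeriv 𝓘(ℝ, EG) 𝓘(ℝ, E) (fun g : G => g • q) 1
        ((trivializationAt EG (TangentSpace 𝓘(ℝ, EG)) (1 : G)).symmL ℝ (1 : G) η))
  rw [h4, h5]
  rfl

theorem contMDiff_momentumQ [ContMDiffSMul 𝓘(ℝ, EG) 𝓘(ℝ, E) ∞ G Q] (η : EG) :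
    ContMDiff (𝓘(ℝ, E).prod 𝓘(ℝ, E →L[ℝ] ℝ)) 𝓘(ℝ, ℝ) ∞
      (fun p : CotangentBundle E Q => momentumQ EG G p η) := by
  have hX := (contMDiff_genQ (E := E) (Q := Q) (G := G) η).comp
    (contMDiff_cotangent_proj (E := E) (Q := Q))
  have hid : ContMDiff (𝓘(ℝ, E).prod 𝓘(ℝ, E →L[ℝ] ℝ)) (𝓘(ℝ, E).prod 𝓘(ℝ, E →L[ℝ] ℝ)) ∞
      (fun p : CotangentBundle E Q => TotalSpace.mk' (E →L[ℝ] ℝ)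
        (E := fun q : Q => TangentSpace 𝓘(ℝ, E) q →L[ℝ] Bundle.Trivial Q ℝ q) p.1 p.2) :=
    contMDiff_id
  have h := ContMDiff.clm_bundle_apply (E₂ := Bundle.Trivial Q ℝ) hid hX
  intro p
  exact (contMDiffAt_totalSpace.1 (h p)).2

namespace IsSymmetry
variable (h : S.IsSymmetry EG G)

theorem contMDiff_momentumM (h : S.IsSymmetry EG G) (η : EG) :
    ContMDiff 𝓘(ℝ, E × (Fin r → ℝ)) 𝓘(ℝ, ℝ) ∞ (fun m : S.M => S.momentumM EG G m η) := by
  have := h.contMDiffSMul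
  exact (contMDiff_momentumQ (EG := EG) (G := G) η).comp S.contMDiff_incl

/-- `i_{η_M} Ω_M = d⟨𝓙, η⟩`. -/
theorem ΩM_genM (m : S.M) (η : EG) (Y : E × (Fin r → ℝ)) :
    S.ΩM m (h.genM m η) Y = modelDeriv 𝓘(ℝ, E × (Fin r → ℝ)) 𝓘(ℝ, ℝ)
      (fun m' : S.M => S.momentumM EG G m' η) m Y := by
  have hsm := h.contMDiffSMul
  have : IsManifold (𝓘(ℝ, E).prod 𝓘(ℝ, E →L[ℝ] ℝ)) 1 (CotangentBundle E Q) :=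
    IsManifold.of_le (n := ∞) (by simp)
  have : IsManifold 𝓘(ℝ, EG) ∞ G := ContMDiffMul.toIsManifold
  have : IsManifold 𝓘(ℝ, EG) 1 G := IsManifold.of_le (n := ∞) (by simp)
  have hμ := contMDiff_momentumQ (E := E) (Q := Q) (EG := EG) (G := G) η
  set p := S.incl m with hp
  -- Cartan's formula is applied on T*Q, where Θ_Q is invariant under the full lift; the result is
  -- then pulled back by ι. The sign in Ω_Q = -dΘ_Q cancels the one in the formula.
  have h1 := extDerivForm_generator (I := 𝓘(ℝ, E).prod 𝓘(ℝ, E →L[ℝ] ℝ))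
    (Φ := fun (g : G) (p : CotangentBundle E Q) => cotangentLift g p) (e := 1) (x := p)
    cotangentLift_one ((contMDiff_cotangentLift.contMDiffAt).of_le (by norm_cast))
    canonicalOneForm (hasFDerivAt_chartForm_canonicalOneForm p).differentiableAt (S.inclDeriv m Y)
    (Filter.Eventually.of_forall fun g => h.canonicalOneForm_cotangentLift g p _) η
    (fun p => modelDeriv 𝓘(ℝ, EG) (𝓘(ℝ, E).prod 𝓘(ℝ, E →L[ℝ] ℝ))
      (fun g : G => cotangentLift g p) 1 η) (fun _ => rfl)
  have h2 := DFunLike.congr_fun (modelDeriv_eq_fderiv (hμ.mdifferentiableAt (x := p) (by simp)))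
    (S.inclDeriv m Y)
  have h3 : S.ΩM m (h.genM m η) Y = modelDeriv (𝓘(ℝ, E).prod 𝓘(ℝ, E →L[ℝ] ℝ)) 𝓘(ℝ, ℝ)
      (fun p : CotangentBundle E Q => momentumQ EG G p η) p (S.inclDeriv m Y) := by
    change -(extDerivForm (𝓘(ℝ, E).prod 𝓘(ℝ, E →L[ℝ] ℝ)) canonicalOneForm p
      (S.inclDeriv m (h.genM m η)) (S.inclDeriv m Y)) = _
    rw [h2, h.inclDeriv_genM]
    have h4 : (fun y => canonicalOneForm ((extChartAt (𝓘(ℝ, E).prod 𝓘(ℝ, E →L[ℝ] ℝ)) p).symm y)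
        (modelDeriv 𝓘(ℝ, EG) (𝓘(ℝ, E).prod 𝓘(ℝ, E →L[ℝ] ℝ)) (fun g : G => cotangentLift g
          ((extChartAt (𝓘(ℝ, E).prod 𝓘(ℝ, E →L[ℝ] ℝ)) p).symm y)) 1 η)) =
        fun y => momentumQ EG G ((extChartAt (𝓘(ℝ, E).prod 𝓘(ℝ, E →L[ℝ] ℝ)) p).symm y) η :=
      funext fun y => h.canonicalOneForm_generator _ η
    have h5 := neg_eq_iff_eq_neg.2 h1
    rw [h4] at h5
    exact h5
  rw [h3]
  exact (mfderiv_comp_apply (I := 𝓘(ℝ, E × (Fin r → ℝ))) (I' := 𝓘(ℝ, E).prod 𝓘(ℝ, E →L[ℝ] ℝ))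
    (I'' := 𝓘(ℝ, ℝ)) (f := S.incl) (g := fun p : CotangentBundle E Q => momentumQ EG G p η) m
    (hμ.mdifferentiableAt (by simp)) (S.contMDiff_incl.mdifferentiableAt (by simp)) Y).symm

end IsSymmetry
end Lifts
end NHSystem
end Nonholonomic

namespace Nonholonomic
namespace NHSystem

variable {E : Type*} [NormedAddCommGroup E] [NormedSpace ℝ E] [FiniteDimensional ℝ E]
  {Q : Type*} [TopologicalSpace Q] [ChartedSpace E Q] [IsManifold 𝓘(ℝ, E) ∞ Q]
  {r : ℕ} {S : NHSystem E Q r}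
  {EG : Type*} [NormedAddCommGroup EG] [NormedSpace ℝ EG]
  {G : Type*} [TopologicalSpace G] [ChartedSpace EG G] [Group G] [LieGroup 𝓘(ℝ, EG) ∞ G]
  [MulAction G Q]
  {W : ∀ q : Q, Submodule ℝ (TangentSpace 𝓘(ℝ, E) q)} {𝔴 : Submodule ℝ (LieAlg EG G)}

/-! ### The splittings of TM and 𝔤 along 𝔴. -/

section Decomposition

variable (h : S.IsSymmetry EG G)

theorem eq_zero_of_genQ_mem_D (hW : S.IsVerticalComplement EG G W) (h𝔴 : VerticalSymmetry W 𝔴)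
    {q : Q} {ζ : LieAlg EG G} (hζ : ζ ∈ 𝔴) (hD : genQ q ζ ∈ S.D q) :
    ζ = 0 := by
  have h3 : genQ q ζ ∈ W q := by
    rw [← h𝔴.map_eq q]
    exact Submodule.mem_map_of_mem hζ
  have h4 : genQ q ζ = 0 := Submodule.disjoint_def.1 (hW.isCompl q).disjoint _ hD h3
  exact h𝔴.injOn q hζ (zero_mem 𝔴) (h4.trans (map_zero _).symm)

theorem exists_sub_genQ_mem_D (hW : S.IsVerticalComplement EG G W) (h𝔴 : VerticalSymmetry W 𝔴)
    {q : Q} (u : TangentSpace 𝓘(ℝ, E) q) :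
    ∃ ζ ∈ 𝔴, u - genQ q ζ ∈ S.D q := by
  have h1 : u ∈ S.D q ⊔ W q := by
    rw [(hW.isCompl q).sup_eq_top]
    trivial
  obtain ⟨d, hd, w, hw, hdw⟩ := Submodule.mem_sup.1 h1
  rw [← h𝔴.map_eq q] at hw
  obtain ⟨ζ, hζ, rfl⟩ := hw
  refine ⟨ζ, hζ, ?_⟩
  rwa [← hdw, add_sub_cancel_right]

variable (S) in
/-- The tangent map `Tτ` of the projection `τ : M → Q`. -/
noncomputable def tangentτ (m : S.M) : S.TM m →ₗ[ℝ] TangentSpace 𝓘(ℝ, E) (S.τ m) :=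
  (mfderiv 𝓘(ℝ, E × (Fin r → ℝ)) 𝓘(ℝ, E) S.τ m).toLinearMap

theorem mem_C_iff_tangentτ {m : S.M} {v : S.TM m} : v ∈ S.C m ↔ S.tangentτ m v ∈ S.D (S.τ m) :=
  Iff.rfl

theorem tangentτ_apply (m : S.M) (v : E × (Fin r → ℝ)) : S.tangentτ m v = v.1 :=
  DFunLike.congr_fun (S.modelDeriv_τ m) v

theorem IsSymmetry.tangentτ_genM (m : S.M) (ζ : LieAlg EG G) :
    S.tangentτ m (h.genM m ζ) = genQ (S.τ m) ζ :=
  (S.tangentτ_apply m _).trans (h.genM_fst m ζ)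

/-- Since Tτ maps η_M to η_Q, the splitting TM = C ⊕ 𝓦 reduces to TQ = D ⊕ W. -/
theorem IsSymmetry.sub_genM_mem_C_iff {m : S.M} {v : S.TM m} {ζ : LieAlg EG G} :
    v - h.genM m ζ ∈ S.C m ↔ S.tangentτ m v - genQ (S.τ m) ζ ∈ S.D (S.τ m) := by
  rw [mem_C_iff_tangentτ, map_sub, h.tangentτ_genM]

theorem IsSymmetry.genM_mem_C_iff {m : S.M} {ζ : LieAlg EG G} :
    h.genM m ζ ∈ S.C m ↔ genQ (S.τ m) ζ ∈ S.D (S.τ m) := by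
  rw [mem_C_iff_tangentτ, h.tangentτ_genM]

theorem IsSymmetry.genM𝔴_injective (hW : S.IsVerticalComplement EG G W) (h𝔴 : VerticalSymmetry W 𝔴)
    (m : S.M) : Function.Injective (h.genM𝔴 𝔴 m) := by
  rw [← LinearMap.ker_eq_bot, LinearMap.ker_eq_bot']
  rintro ⟨ζ, hζ⟩ h0
  refine Subtype.ext (eq_zero_of_genQ_mem_D (q := S.τ m) hW h𝔴 hζ ?_)
  rw [← h.genM_mem_C_iff]
  have : h.genM m ζ = 0 := h0
  rw [this]
  exact zero_mem _

theorem IsSymmetry.isCompl_C_WM (hW : S.IsVerticalComplement EG G W) (h𝔴 : VerticalSymmetry W 𝔴)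
    (m : S.M) : IsCompl (S.C m) (h.WM 𝔴 m) := by
  constructor
  · rw [Submodule.disjoint_def]
    rintro _ hX ⟨⟨ζ, hζ⟩, rfl⟩
    obtain rfl := eq_zero_of_genQ_mem_D (q := S.τ m) hW h𝔴 hζ (h.genM_mem_C_iff.1 hX)
    exact map_zero (h.genM m)
  · rw [codisjoint_iff, eq_top_iff]
    intro v _
    obtain ⟨ζ, hζ, hD⟩ := exists_sub_genQ_mem_D (q := S.τ m) hW h𝔴 (S.tangentτ m v)
    exact Submodule.mem_sup.2 ⟨_, h.sub_genM_mem_C_iff.2 hD, _, ⟨⟨ζ, hζ⟩, rfl⟩, sub_add_cancel _ _⟩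

/-- All later computations with A_𝓦 use this criterion in place of the projections that define it.
-/
theorem IsSymmetry.AW_eq (hW : S.IsVerticalComplement EG G W) (h𝔴 : VerticalSymmetry W 𝔴)
    {m : S.M} {v : S.TM m} {ζ : LieAlg EG G} (hζ : ζ ∈ 𝔴)
    (hv : v - h.genM m ζ ∈ S.C m) : h.AW 𝔴 m v = ζ := by
  have hc := h.isCompl_C_WM hW h𝔴 m
  have hi := h.genM𝔴_injective hW h𝔴 m
  have hmem : h.genM m ζ ∈ h.WM 𝔴 m := ⟨⟨ζ, hζ⟩, rfl⟩
  have h1 : h.projW 𝔴 m v = ⟨h.genM m ζ, hmem⟩ := by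
    rw [IsSymmetry.projW, dif_pos hc]
    rw [← sub_add_cancel v (h.genM m ζ), map_add,
      (Submodule.projectionOnto_apply_eq_zero_iff hc.symm).2 hv, zero_add]
    exact Submodule.projectionOnto_apply_left hc.symm ⟨h.genM m ζ, hmem⟩
  have h2 : (LinearEquiv.ofInjective (h.genM𝔴 𝔴 m) hi).symm ⟨h.genM m ζ, hmem⟩ = ⟨ζ, hζ⟩ := by
    rw [LinearEquiv.symm_apply_eq]
    rfl
  have h3 : h.AW 𝔴 m = _ := dif_pos hi
  refine (DFunLike.congr_fun h3 v).trans ?_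
  exact congrArg Subtype.val ((congrArg _ h1).trans h2)

theorem IsSymmetry.AW_eq_zero (hW : S.IsVerticalComplement EG G W) (h𝔴 : VerticalSymmetry W 𝔴)
    {m : S.M} {v : S.TM m} (hv : v ∈ S.C m) : h.AW 𝔴 m v = 0 := by
  refine h.AW_eq hW h𝔴 (ζ := (0 : LieAlg EG G)) (zero_mem 𝔴) ?_
  have h0 : h.genM m (0 : LieAlg EG G) = 0 := map_zero _
  rwa [h0, sub_zero]

theorem IsSymmetry.projC_eq (hW : S.IsVerticalComplement EG G W) (h𝔴 : VerticalSymmetry W 𝔴)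
    {m : S.M} {v : S.TM m} (hv : v ∈ S.C m) : h.projC 𝔴 m v = v := by
  rw [IsSymmetry.projC, dif_pos (h.isCompl_C_WM hW h𝔴 m)]
  exact Submodule.projection_apply_left _ ⟨v, hv⟩

theorem projGS_eq (hW : S.IsVerticalComplement EG G W) (h𝔴 : VerticalSymmetry W 𝔴)
    {q : Q} {θ ζ : LieAlg EG G} (hζ : ζ ∈ 𝔴) (hD : genQ q θ - genQ q ζ ∈ S.D q) :
    (projGS hW h𝔴 q θ : LieAlg EG G) = θ - ζ := by
  have hc := isCompl_gS hW h𝔴 q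
  have hmem : θ - ζ ∈ S.gS EG G q := by
    refine ⟨?_, LinearMap.mem_range_self _ _⟩
    change genQ q (θ - ζ) ∈ S.D q
    rwa [map_sub]
  have h1 : projGS hW h𝔴 q θ = ⟨θ - ζ, hmem⟩ := by
    rw [projGS]
    conv_lhs => rw [← sub_add_cancel θ ζ]
    rw [map_add, (Submodule.projectionOnto_apply_eq_zero_iff hc).2 hζ, add_zero]
    exact Submodule.projectionOnto_apply_left hc ⟨θ - ζ, hmem⟩
  rw [h1]

end Decomposition

/-! ### Smoothness of the projection onto 𝔴. -/

section LocalConnection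


/-- The projection of `TQ = D ⊕ W` onto `W ≅ 𝔴 × Q`, regarded as a 1-form with values in `𝔴`, is
smooth. -/
theorem exists_connection (hW : S.IsVerticalComplement EG G W) (h𝔴 : VerticalSymmetry W 𝔴)
    [ContMDiffSMul 𝓘(ℝ, EG) 𝓘(ℝ, E) ∞ G Q] {l : ℕ}
    {e : Fin l → LieAlg EG G} (he : LinearIndependent ℝ e)
    (hspan : Submodule.span ℝ (Set.range e) = 𝔴) (q₀ : Q) :
    ∃ A : Q → (E →L[ℝ] EG), ContMDiffAt 𝓘(ℝ, E) 𝓘(ℝ, E →L[ℝ] EG) ∞ A q₀ ∧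
      ∀ᶠ q in 𝓝 q₀, ∀ u : TangentSpace 𝓘(ℝ, E) q,
        (A q ((trivializationAt E (TangentSpace 𝓘(ℝ, E)) q₀).continuousLinearMapAt ℝ q u)) ∈ 𝔴 ∧
        u - genQ (EG := EG) (G := G) q (A q ((trivializationAt E (TangentSpace 𝓘(ℝ, E)) q₀).continuousLinearMapAt ℝ q u))
          ∈ S.D q := by
  set t := trivializationAt E (TangentSpace 𝓘(ℝ, E)) q₀ with ht
  let e' : Fin l → EG := e
  let V := (Fin r → ℝ) × (Fin l → ℝ)
  let c : Fin r → V →L[ℝ] ℝ := fun a =>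
    (ContinuousLinearMap.proj a : (Fin r → ℝ) →L[ℝ] ℝ).comp (.fst ℝ (Fin r → ℝ) (Fin l → ℝ))
  let d : Fin l → V →L[ℝ] ℝ := fun b =>
    (ContinuousLinearMap.proj b : (Fin l → ℝ) →L[ℝ] ℝ).comp (.snd ℝ (Fin r → ℝ) (Fin l → ℝ))
  let K : V →L[ℝ] EG := ∑ b, (d b).smulRight (e' b)
  let Kg : V → LieAlg EG G := fun w => ∑ b, w.2 b • e b
  have hK : ∀ w : V, K w = Kg w := fun w => by
    have h1 : K w = ∑ b, w.2 b • e' b := by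
      simp only [K, sum_apply]
      rfl
    exact h1
  have hKmem : ∀ w : V, Kg w ∈ 𝔴 := fun w => by
    rw [← hspan, Submodule.mem_span_range_iff_exists_fun]
    exact ⟨_, rfl⟩
  let x : Fin r → Q → E := fun a q => t.continuousLinearMapAt ℝ q (S.frame q₀ a q)
  let y : Fin l → Q → E := fun b q => t.continuousLinearMapAt ℝ q (genQ (EG := EG) (G := G) q (e b))
  -- `B q` sends coefficients (a, b) to the coordinates of Σ a_i X_i + Σ b_j (e_j)_Q, where the X_i
  -- are the local frame of D. It is invertible because TQ = D ⊕ W and Ψ is injective on 𝔴.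
  let B : Q → (V →L[ℝ] E) := fun q =>
    ∑ a, (c a).smulRight (x a q) + ∑ b, (d b).smulRight (y b q)
  have hU : ∀ᶠ q in 𝓝 q₀, q ∈ t.baseSet ∧ q ∈ S.frameSet q₀ :=
    Filter.Eventually.and
      (t.open_baseSet.mem_nhds (mem_baseSet_trivializationAt _ _ _))
      ((S.isOpen_frameSet q₀).mem_nhds (S.mem_frameSet q₀))
  have ht2 : ∀ q ∈ t.baseSet, ∀ v : TangentSpace 𝓘(ℝ, E) q,
      (t ⟨q, v⟩).2 = t.continuousLinearMapAt ℝ q v := fun q hq v =>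
    (congrFun (t.coe_linearMapAt_of_mem (R := ℝ) hq) v).symm
  have hx : ∀ a, ContMDiffAt 𝓘(ℝ, E) 𝓘(ℝ, E) ∞ (x a) q₀ := fun a => by
    have h1 := (S.contMDiffOn_frame q₀ a).contMDiffAt
      ((S.isOpen_frameSet q₀).mem_nhds (S.mem_frameSet q₀))
    refine (contMDiffAt_totalSpace.1 h1).2.congr_of_eventuallyEq ?_
    filter_upwards [hU] with q hq
    exact (ht2 q hq.1 _).symm
  have hy : ∀ b, ContMDiffAt 𝓘(ℝ, E) 𝓘(ℝ, E) ∞ (y b) q₀ := fun b => by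
    have h1 := contMDiff_genQ (E := E) (Q := Q) (G := G) (e' b) q₀
    refine (contMDiffAt_totalSpace.1 h1).2.congr_of_eventuallyEq ?_
    filter_upwards [hU] with q hq
    exact (ht2 q hq.1 _).symm
  have hB : ContMDiffAt 𝓘(ℝ, E) 𝓘(ℝ, V →L[ℝ] E) ∞ B q₀ := by
    refine ContMDiffAt.add ?_ ?_
    · refine contMDiffAt_finsetSum fun a _ => ?_
      exact (ContinuousLinearMap.smulRightL ℝ V E (c a)).contMDiff.contMDiffAt.comp q₀ (hx a)
    · refine contMDiffAt_finsetSum fun b _ => ?_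
      exact (ContinuousLinearMap.smulRightL ℝ V E (d b)).contMDiff.contMDiffAt.comp q₀ (hy b)
  have hBq : ∀ (q : Q) (w : V), B q w = t.continuousLinearMapAt ℝ q
      (∑ a, w.1 a • S.frame q₀ a q + genQ q (Kg w)) := fun q w => by
    have h1 : B q w = ∑ a, w.1 a • x a q + ∑ b, w.2 b • y b q := by
      simp only [B, add_apply, sum_apply]
      rfl
    rw [h1, map_add, map_sum, map_sum, map_sum]
    simp only [map_smul]
    rfl
  have hinv : ∀ q, q ∈ t.baseSet ∧ q ∈ S.frameSet q₀ → ∃ f : V ≃L[ℝ] E, (f : V →L[ℝ] E) = B q := by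
    rintro q ⟨hq1, hq2⟩
    have hDmem : ∀ w : V, ∑ a, w.1 a • S.frame q₀ a q ∈ S.D q := fun w => by
      rw [← S.span_frame q₀ hq2, Submodule.mem_span_range_iff_exists_fun]
      exact ⟨_, rfl⟩
    have hinj : Function.Injective (B q).toLinearMap := by
      rw [← LinearMap.ker_eq_bot, LinearMap.ker_eq_bot']
      intro w hw
      have hw1 : t.continuousLinearMapAt ℝ q (∑ a, w.1 a • S.frame q₀ a q + genQ q (Kg w)) = 0 :=
        (hBq q w).symm.trans hw
      have hw2 : ∑ a, w.1 a • S.frame q₀ a q + genQ q (Kg w) = 0 := by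
        have h3 := t.symmL_continuousLinearMapAt (R := ℝ) hq1
          (∑ a, w.1 a • S.frame q₀ a q + genQ q (Kg w))
        rw [hw1, map_zero] at h3
        exact h3.symm
      have hK0 : Kg w = 0 := by
        refine eq_zero_of_genQ_mem_D hW h𝔴 (hKmem w) (q := q) ?_
        rw [eq_neg_of_add_eq_zero_right hw2]
        exact neg_mem (hDmem w)
      have h2 : w.2 = 0 := by
        funext b
        exact Fintype.linearIndependent_iff.1 he w.2 hK0 b
      have h1 : w.1 = 0 := by
        rw [hK0, map_zero, add_zero] at hw2
        funext a
        exact Fintype.linearIndependent_iff.1 (S.linearIndependent_frame q₀ hq2) w.1 hw2 a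
      exact Prod.ext h1 h2
    have hsurj : Function.Surjective (B q).toLinearMap := by
      intro z
      obtain ⟨ζ, hζ, hD⟩ := exists_sub_genQ_mem_D hW h𝔴 (t.symmL ℝ q z)
      rw [← S.span_frame q₀ hq2, Submodule.mem_span_range_iff_exists_fun] at hD
      rw [← hspan, Submodule.mem_span_range_iff_exists_fun] at hζ
      obtain ⟨a, ha⟩ := hD
      obtain ⟨b, hb⟩ := hζ
      refine ⟨(a, b), (hBq q (a, b)).trans ?_⟩
      have h3 : Kg (a, b) = ζ := hb
      rw [h3]
      simp only
      rw [ha, sub_add_cancel]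
      exact t.continuousLinearMapAt_symmL (R := ℝ) hq1 z
    exact ⟨(LinearEquiv.ofBijective (B q).toLinearMap ⟨hinj, hsurj⟩).toContinuousLinearEquiv, by
      ext <;> rfl⟩
  -- Solve for the coefficients and keep the part in 𝔴. Smoothness follows from that of inversion of
  -- continuous linear maps.
  refine ⟨fun q => K.comp (B q).inverse, ?_, ?_⟩
  · obtain ⟨f, hf⟩ := hinv q₀ hU.self_of_nhds
    have h1 : ContMDiffAt 𝓘(ℝ, V →L[ℝ] E) 𝓘(ℝ, E →L[ℝ] V) ∞ ContinuousLinearMap.inverse (B q₀) := by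
      rw [← hf]
      exact (contDiffAt_map_inverse f).contMDiffAt
    exact contMDiffAt_const.clm_comp (h1.comp q₀ hB)
  · filter_upwards [hU] with q hq u
    obtain ⟨f, hf⟩ := hinv q hq
    set w := (B q).inverse (t.continuousLinearMapAt ℝ q u) with hw
    have h1 : B q w = t.continuousLinearMapAt ℝ q u := by
      rw [hw, ← hf, ContinuousLinearMap.inverse_equiv]
      simp
    have h2 : ∑ a, w.1 a • S.frame q₀ a q + genQ q (Kg w) = u := by
      have h3 := congrArg (t.symmL ℝ q) h1
      rwa [hBq, t.symmL_continuousLinearMapAt (R := ℝ) hq.1,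
        t.symmL_continuousLinearMapAt (R := ℝ) hq.1] at h3
    have h4 : Kg w ∈ 𝔴 ∧ u - genQ q (Kg w) ∈ S.D q := by
      refine ⟨hKmem w, ?_⟩
      rw [← h2, add_sub_cancel_right, ← S.span_frame q₀ hq.2,
        Submodule.mem_span_range_iff_exists_fun]
      exact ⟨_, rfl⟩
    have key : ∀ z : LieAlg EG G, z = Kg w → z ∈ 𝔴 ∧ u - genQ q z ∈ S.D q := by
      rintro _ rfl
      exact h4
    exact key _ (hK w)

end LocalConnection
end NHSystem
end Nonholonomic

namespace Nonholonomic

/-! ### Leibniz' rule for pairings with vector-valued functions. -/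

section VectorValued

variable {E' : Type*} [NormedAddCommGroup E'] [NormedSpace ℝ E']
  {H : Type*} [TopologicalSpace H] {I : ModelWithCorners ℝ E' H} [I.Boundaryless]
  {N : Type*} [TopologicalSpace N] [ChartedSpace H N] [IsManifold I 1 N]
  {F : Type*} [NormedAddCommGroup F] [NormedSpace ℝ F]

theorem hasFDerivAt_comp_extChartAt_symm {f : N → F} {x : N}
    (hf : MDifferentiableAt I 𝓘(ℝ, F) f x) :
    HasFDerivAt (fun y => f ((extChartAt I x).symm y)) (modelDeriv I 𝓘(ℝ, F) f x)
      (extChartAt I x x) := by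
  rw [modelDeriv_eq_fderiv hf]
  refine DifferentiableAt.hasFDerivAt ?_
  have h := hasFDerivAt_chart (I := I) (I₂ := 𝓘(ℝ, F)) (f := f) (x₀ := x) (z₀ := f x)
    (mem_extChartAt_target (I := I) x)
    (by rw [extChartAt_to_inv]; exact mem_extChartAt_source _) (by rwa [extChartAt_to_inv])
  exact h.differentiableAt

/-- Leibniz' rule for the pairing of a vector-valued function with a linear form depending on the
point. -/
theorem fderiv_sum_mul {V ι : Type*} [NormedAddCommGroup V] [NormedSpace ℝ V] [Fintype ι]
    (L : ι → F →L[ℝ] ℝ) {P : ι → V → ℝ} {x : V → F} {P' : ι → V →L[ℝ] ℝ} {x' : V →L[ℝ] F} {y : V}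
    (hP : ∀ c, HasFDerivAt (P c) (P' c) y) (hx : HasFDerivAt x x' y) (v : V) :
    fderiv ℝ (fun z => ∑ c, L c (x z) * P c z) y v =
      fderiv ℝ (fun z => ∑ c, L c (x y) * P c z) y v + ∑ c, L c (x' v) * P c y := by
  have h1 := HasFDerivAt.fun_sum (u := Finset.univ) fun c _ => ((L c).hasFDerivAt.comp y hx).mul (hP c)
  have h2 := HasFDerivAt.fun_sum (u := Finset.univ) fun c _ => (hP c).const_mul (L c (x y))
  have h3 : fderiv ℝ (fun z => ∑ c, L c (x z) * P c z) y = _ := h1.fderiv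
  rw [h3, h2.fderiv]
  simp only [sum_apply, add_apply, smul_apply, ContinuousLinearMap.comp_apply, smul_eq_mul,
    Finset.sum_add_distrib]
  congr 1
  exact Finset.sum_congr rfl fun c _ => mul_comm _ _

end VectorValued

/-! ### The curvature term and the nonholonomic momentum functions. -/

namespace NHSystem

variable {E : Type*} [NormedAddCommGroup E] [NormedSpace ℝ E] [FiniteDimensional ℝ E]
  {Q : Type*} [TopologicalSpace Q] [ChartedSpace E Q] [IsManifold 𝓘(ℝ, E) ∞ Q]
  {r : ℕ} {S : NHSystem E Q r}
  {EG : Type*} [NormedAddCommGroup EG] [NormedSpace ℝ EG]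
  {G : Type*} [TopologicalSpace G] [ChartedSpace EG G] [Group G] [LieGroup 𝓘(ℝ, EG) ∞ G]
  [MulAction G Q]
  {W : ∀ q : Q, Submodule ℝ (TangentSpace 𝓘(ℝ, E) q)} {𝔴 : Submodule ℝ (LieAlg EG G)}
  (h : S.IsSymmetry EG G) (hW : S.IsVerticalComplement EG G W) (h𝔴 : VerticalSymmetry W 𝔴)

/-- This extends `modelDeriv_τ` to the whole chart domain, as is needed to differentiate forms
obtained through τ. -/
theorem modelDeriv_extChartAt_tangentτ {m : S.M} {y : E × (Fin r → ℝ)}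
    (hy : y ∈ (extChartAt 𝓘(ℝ, E × (Fin r → ℝ)) m).target) (v : E × (Fin r → ℝ)) :
    modelDeriv 𝓘(ℝ, E) 𝓘(ℝ, E) (extChartAt 𝓘(ℝ, E) (S.τ m))
      (S.τ ((extChartAt 𝓘(ℝ, E × (Fin r → ℝ)) m).symm y))
      (S.tangentτ ((extChartAt 𝓘(ℝ, E × (Fin r → ℝ)) m).symm y)
        (modelDeriv 𝓘(ℝ, E × (Fin r → ℝ)) 𝓘(ℝ, E × (Fin r → ℝ))
          (extChartAt 𝓘(ℝ, E × (Fin r → ℝ)) m).symm y v)) = v.1 := by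
  have : IsManifold 𝓘(ℝ, E) 1 Q := IsManifold.of_le (n := ∞) (by simp)
  have : IsManifold 𝓘(ℝ, E × (Fin r → ℝ)) 1 S.M := IsManifold.of_le (n := ∞) (by simp)
  have hsrc := S.mem_extChartAt_source_iff.1
    ((extChartAt 𝓘(ℝ, E × (Fin r → ℝ)) m).map_target hy)
  have h1 := hasFDerivAt_chart (I := 𝓘(ℝ, E × (Fin r → ℝ))) (I₂ := 𝓘(ℝ, E)) (f := S.τ) (x₀ := m)
    (z₀ := S.τ m) hy (by rw [extChartAt_source]; exact hsrc.1)
    (S.contMDiff_τ.mdifferentiableAt (by simp))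
  have h2 : HasFDerivAt (fun y => extChartAt 𝓘(ℝ, E) (S.τ m)
      (S.τ ((extChartAt 𝓘(ℝ, E × (Fin r → ℝ)) m).symm y))) (.fst ℝ E (Fin r → ℝ)) y := by
    refine hasFDerivAt_fst.congr_of_eventuallyEq ?_
    filter_upwards [(isOpen_extChartAt_target (I := 𝓘(ℝ, E × (Fin r → ℝ))) m).mem_nhds hy] with z hz
    rw [S.τ_extChartAt_symm hz]
    exact (chartAt E (S.τ m)).right_inv (S.mem_extChartAt_target_iff.1 hz).1
  exact DFunLike.congr_fun (h1.unique h2) v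

/-- The 1-form `A_𝓦` is differentiable. -/
theorem IsSymmetry.differentiableAt_chartForm_AW (hW : S.IsVerticalComplement EG G W)
    (h𝔴 : VerticalSymmetry W 𝔴) {l : ℕ} {e : Fin l → LieAlg EG G}
    (he : LinearIndependent ℝ e) (hspan : Submodule.span ℝ (Set.range e) = 𝔴) (m : S.M) :
    DifferentiableAt ℝ (chartForm 𝓘(ℝ, E × (Fin r → ℝ)) (h.AW 𝔴) m)
      (extChartAt 𝓘(ℝ, E × (Fin r → ℝ)) m m) := by
  have := h.contMDiffSMul
  have : IsManifold 𝓘(ℝ, E) 1 Q := IsManifold.of_le (n := ∞) (by simp)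
  have : IsManifold 𝓘(ℝ, E × (Fin r → ℝ)) 1 S.M := IsManifold.of_le (n := ∞) (by simp)
  obtain ⟨A, hA, hA'⟩ := exists_connection hW h𝔴 he hspan (S.τ m)
  have hAτ : MDifferentiableAt 𝓘(ℝ, E × (Fin r → ℝ)) 𝓘(ℝ, E →L[ℝ] EG) (fun m' => A (S.τ m')) m :=
    (hA.mdifferentiableAt (by simp)).comp m (S.contMDiff_τ.mdifferentiableAt (by simp))
  have h1 := (hasFDerivAt_comp_extChartAt_symm hAτ).differentiableAt
  -- In coordinates A_𝓦 is the pullback by τ of the local connection form on Q: it depends on a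
  -- tangent vector of M only through its image in TQ.
  have h2 : DifferentiableAt ℝ (fun y : E × (Fin r → ℝ) =>
      (A (S.τ ((extChartAt 𝓘(ℝ, E × (Fin r → ℝ)) m).symm y))).comp (.fst ℝ E (Fin r → ℝ)))
      (extChartAt 𝓘(ℝ, E × (Fin r → ℝ)) m m) :=
    h1.clm_comp (differentiableAt_const _)
  refine h2.congr_of_eventuallyEq ?_
  have hc : ContinuousAt (fun y => S.τ ((extChartAt 𝓘(ℝ, E × (Fin r → ℝ)) m).symm y))
      (extChartAt 𝓘(ℝ, E × (Fin r → ℝ)) m m) :=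
    S.continuous_τ.continuousAt.comp (continuousAt_extChartAt_symm m)
  have hc0 : S.τ ((extChartAt 𝓘(ℝ, E × (Fin r → ℝ)) m).symm
      (extChartAt 𝓘(ℝ, E × (Fin r → ℝ)) m m)) = S.τ m := by rw [extChartAt_to_inv]
  rw [← hc0] at hA'
  filter_upwards [hc.eventually hA', extChartAt_target_mem_nhds (I := 𝓘(ℝ, E × (Fin r → ℝ))) m]
    with y hy hyt
  rw [hc0] at hy
  refine ContinuousLinearMap.ext fun v => ?_
  set m' := (extChartAt 𝓘(ℝ, E × (Fin r → ℝ)) m).symm y with hm'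
  set v' : S.TM m' := modelDeriv 𝓘(ℝ, E × (Fin r → ℝ)) 𝓘(ℝ, E × (Fin r → ℝ))
    (extChartAt 𝓘(ℝ, E × (Fin r → ℝ)) m).symm y v with hv'
  have hsrc := S.mem_extChartAt_source_iff.1
    ((extChartAt 𝓘(ℝ, E × (Fin r → ℝ)) m).map_target hyt)
  have h3 := modelDeriv_extChartAt_tangentτ hyt v
  have h4 : (trivializationAt E (TangentSpace 𝓘(ℝ, E)) (S.τ m)).continuousLinearMapAt ℝ (S.τ m')
      (S.tangentτ m' v') = v.1 :=
    (DFunLike.congr_fun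
      (TangentBundle.continuousLinearMapAt_trivializationAt (I := 𝓘(ℝ, E)) hsrc.1) _).trans h3
  have h5 := hy (S.tangentτ m' v')
  rw [h4] at h5
  exact h.AW_eq hW h𝔴 h5.1 (h.sub_genM_mem_C_iff.2 h5.2)

theorem sub_projGS_mem (q : Q) (θ : LieAlg EG G) :
    θ - (projGS hW h𝔴 q θ : LieAlg EG G) ∈ 𝔴 := by
  obtain ⟨ζ, hζ, hD⟩ := exists_sub_genQ_mem_D hW h𝔴 (genQ q θ)
  rwa [projGS_eq hW h𝔴 hζ hD, sub_sub_cancel]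

/-- Locally the section is θ - A(θ_Q), where A is the smooth connection form. -/
theorem isSmoothSection_projGS [ContMDiffSMul 𝓘(ℝ, EG) 𝓘(ℝ, E) ∞ G Q] {l : ℕ}
    {e : Fin l → LieAlg EG G} (he : LinearIndependent ℝ e)
    (hspan : Submodule.span ℝ (Set.range e) = 𝔴) (θ : LieAlg EG G) :
    IsSmoothSection fun q => projGS hW h𝔴 q θ := by
  intro q₀
  obtain ⟨A, hA, hA'⟩ := exists_connection hW h𝔴 he hspan q₀
  set t := trivializationAt E (TangentSpace 𝓘(ℝ, E)) q₀ with ht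
  let θ' : EG := θ
  have hθ : ContMDiffAt 𝓘(ℝ, E) 𝓘(ℝ, E) ∞
      (fun q => t.continuousLinearMapAt ℝ q (genQ q θ)) q₀ := by
    have h1 := contMDiff_genQ (E := E) (Q := Q) (G := G) θ' q₀
    refine (contMDiffAt_totalSpace.1 h1).2.congr_of_eventuallyEq ?_
    filter_upwards [t.open_baseSet.mem_nhds (mem_baseSet_trivializationAt _ _ _)] with q hq
    exact congrFun (t.coe_linearMapAt_of_mem (R := ℝ) hq) _
  have h1 : ContMDiffAt 𝓘(ℝ, E) 𝓘(ℝ, EG) ∞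
      (fun q => θ' - A q (t.continuousLinearMapAt ℝ q (genQ q θ))) q₀ :=
    contMDiffAt_const.sub (hA.clm_apply hθ)
  refine h1.congr_of_eventuallyEq ?_
  filter_upwards [hA'] with q hq
  exact projGS_eq hW h𝔴 (hq _).1 (hq _).2

/-- A section of `𝔤_S` as a map with values in the model space of `G`. -/
def sectionVal (x : ∀ q : Q, S.gS EG G q) (q : Q) : EG :=
  (x q).val

variable [FiniteDimensional ℝ EG]

theorem momentumM_eq_sum {ι : Type*} [Fintype ι] (b : Module.Basis ι ℝ (LieAlg EG G)) (m : S.M)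
    (θ : LieAlg EG G) : S.momentumM EG G m θ = ∑ c, b.coord c θ * S.momentumM EG G m (b c) := by
  conv_lhs => rw [← b.sum_repr θ]
  rw [map_sum]
  simp

theorem IsSymmetry.nhMomentum_eq (x : ∀ q : Q, S.gS EG G q) (m : S.M) :
    h.nhMomentum x m = S.momentumM EG G m (x (S.τ m)) :=
  h.ΘM_genM m (x (S.τ m)).1

theorem IsSymmetry.contMDiff_nhMomentum {x : ∀ q : Q, S.gS EG G q} (hx : IsSmoothSection x) :
    ContMDiff 𝓘(ℝ, E × (Fin r → ℝ)) 𝓘(ℝ, ℝ) ∞ (h.nhMomentum x) := by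
  let b : Module.Basis (Fin (Module.finrank ℝ EG)) ℝ (LieAlg EG G) := Module.finBasis ℝ EG
  let L : Fin (Module.finrank ℝ EG) → EG →L[ℝ] ℝ := fun c =>
    LinearMap.toContinuousLinearMap (b.coord c)
  let x' : Q → EG := sectionVal x
  have hfun : h.nhMomentum x = fun m => ∑ c, L c (x' (S.τ m)) * S.momentumM EG G m (b c) := by
    funext m
    rw [h.nhMomentum_eq, momentumM_eq_sum b]
    rfl
  have hx' : ContMDiff 𝓘(ℝ, E × (Fin r → ℝ)) 𝓘(ℝ, EG) ∞ fun m => x' (S.τ m) :=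
    ContMDiff.comp (g := x') hx S.contMDiff_τ
  rw [hfun]
  refine contMDiff_finsetSum fun c _ => ?_
  exact ((L c).contMDiff.comp hx').mul (h.contMDiff_momentumM (b c))

/-- Leibniz' rule for `⟨J^nh, ξ⟩ = ⟨𝓙, ξ⟩`. -/
theorem IsSymmetry.modelDeriv_nhMomentum {x : ∀ q : Q, S.gS EG G q} (hx : IsSmoothSection x)
    (m : S.M) (Y : E × (Fin r → ℝ)) :
    modelDeriv 𝓘(ℝ, E × (Fin r → ℝ)) 𝓘(ℝ, ℝ) (h.nhMomentum x) m Y =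
      modelDeriv 𝓘(ℝ, E × (Fin r → ℝ)) 𝓘(ℝ, ℝ)
        (fun m' => S.momentumM EG G m' (x (S.τ m))) m Y +
      S.momentumM EG G m (modelDeriv 𝓘(ℝ, E × (Fin r → ℝ)) 𝓘(ℝ, EG)
        (fun m' => sectionVal x (S.τ m')) m Y) := by
  have : IsManifold 𝓘(ℝ, E × (Fin r → ℝ)) 1 S.M := IsManifold.of_le (n := ∞) (by simp)
  -- A fixed basis of 𝔤 turns the pairing ⟨𝓙, ξ⟩ into a finite sum of products of scalar functions.
  let b : Module.Basis (Fin (Module.finrank ℝ EG)) ℝ (LieAlg EG G) := Module.finBasis ℝ EG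
  let L : Fin (Module.finrank ℝ EG) → EG →L[ℝ] ℝ := fun c =>
    LinearMap.toContinuousLinearMap (b.coord c)
  let x' : Q → EG := sectionVal x
  have hx' : ContMDiff 𝓘(ℝ, E × (Fin r → ℝ)) 𝓘(ℝ, EG) ∞ fun m => x' (S.τ m) :=
    ContMDiff.comp (g := x') hx S.contMDiff_τ
  have hsum : ∀ (m' : S.M) (θ : EG), S.momentumM EG G m' θ =
      ∑ c, L c θ * S.momentumM EG G m' (b c) := fun m' θ => momentumM_eq_sum b m' θ
  have h1 := hasFDerivAt_comp_extChartAt_symm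
    ((h.contMDiff_nhMomentum hx).mdifferentiableAt (x := m) (by simp))
  have h2 := hasFDerivAt_comp_extChartAt_symm
    ((h.contMDiff_momentumM (x' (S.τ m))).mdifferentiableAt (x := m) (by simp))
  have h3 := hasFDerivAt_comp_extChartAt_symm (hx'.mdifferentiableAt (x := m) (by simp))
  have h4 := fderiv_sum_mul L (fun c => hasFDerivAt_comp_extChartAt_symm
    ((h.contMDiff_momentumM (b c)).mdifferentiableAt (x := m) (by simp))) h3 Y
  rw [extChartAt_to_inv] at h4
  have e1 : (fun y => h.nhMomentum x ((extChartAt 𝓘(ℝ, E × (Fin r → ℝ)) m).symm y)) = fun y =>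
      ∑ c, L c (x' (S.τ ((extChartAt 𝓘(ℝ, E × (Fin r → ℝ)) m).symm y))) *
        S.momentumM EG G ((extChartAt 𝓘(ℝ, E × (Fin r → ℝ)) m).symm y) (b c) :=
    funext fun y => (h.nhMomentum_eq x _).trans (hsum _ _)
  have e2 : (fun y => S.momentumM EG G ((extChartAt 𝓘(ℝ, E × (Fin r → ℝ)) m).symm y)
      (x' (S.τ m))) = fun y => ∑ c, L c (x' (S.τ m)) *
        S.momentumM EG G ((extChartAt 𝓘(ℝ, E × (Fin r → ℝ)) m).symm y) (b c) :=
    funext fun y => hsum _ _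
  rw [← e1, ← e2, h1.fderiv, h2.fderiv, ← hsum] at h4
  exact h4

/-- `dA_𝓦 (ξ_M, Y) = dξ (Y)` for `ξ = P_{𝔤_S} (θ)` and `Y` in `C`. -/
theorem IsSymmetry.extDerivForm_AW {l : ℕ} {e : Fin l → LieAlg EG G}
    (hW : S.IsVerticalComplement EG G W) (h𝔴 : VerticalSymmetry W 𝔴)
    (he : LinearIndependent ℝ e) (hspan : Submodule.span ℝ (Set.range e) = 𝔴) (θ : LieAlg EG G)
    {m : S.M} {Y : E × (Fin r → ℝ)} (hY : Y ∈ S.C m) :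
    extDerivForm 𝓘(ℝ, E × (Fin r → ℝ)) (h.AW 𝔴) m
      (h.sectionGen (fun q => projGS hW h𝔴 q θ) m) Y =
    modelDeriv 𝓘(ℝ, E × (Fin r → ℝ)) 𝓘(ℝ, EG)
        (fun m' => sectionVal (fun q => projGS hW h𝔴 q θ) (S.τ m')) m Y := by
  have := h.contMDiffSMul
  have : IsManifold 𝓘(ℝ, E × (Fin r → ℝ)) 1 S.M := IsManifold.of_le (n := ∞) (by simp)
  have : IsManifold 𝓘(ℝ, EG) ∞ G := ContMDiffMul.toIsManifold
  have : IsManifold 𝓘(ℝ, EG) 1 G := IsManifold.of_le (n := ∞) (by simp)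
  let x : Q → LieAlg EG G := fun q => projGS hW h𝔴 q θ
  let x' : Q → EG := sectionVal fun q => projGS hW h𝔴 q θ
  have hx' : ContMDiff 𝓘(ℝ, E × (Fin r → ℝ)) 𝓘(ℝ, EG) ∞ fun m => x' (S.τ m) :=
    ContMDiff.comp (g := x') (isSmoothSection_projGS hW h𝔴 he hspan θ) S.contMDiff_τ
  have h1 := extDerivForm_generator (I := 𝓘(ℝ, E × (Fin r → ℝ)))
    (Φ := fun (g : G) (m : S.M) => h.act g m) (e := 1) (x := m)
    h.act_one ((h.contMDiff_act.contMDiffAt).of_le (by norm_cast))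
    (h.AW 𝔴) (h.differentiableAt_chartForm_AW hW h𝔴 he hspan m) Y
    -- The transformed vector stays in C, where A_𝓦 vanishes, so the value on `Y` is constantly
    -- zero.
    (Filter.Eventually.of_forall fun g => by
      rw [h.AW_eq_zero hW h𝔴 (h.act_mem_C hY g), h.AW_eq_zero hW h𝔴 hY])
    -- The generator must come from a fixed element of 𝔤: ξ is frozen at its value over m, which
    -- does not change ξ_M at m itself.
    (x' (S.τ m)) (fun m' => h.genM m' (x (S.τ m))) (fun _ => rfl)
  have h2 : ∀ m' : S.M, h.AW 𝔴 m' (h.genM m' (x (S.τ m))) = x' (S.τ m) - x' (S.τ m') := by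
    intro m'
    refine h.AW_eq hW h𝔴 (ζ := x (S.τ m) - x (S.τ m')) ?_ ?_
    -- Both values of ξ differ from the same θ by elements of 𝔴, so their difference lies in 𝔴. This
    -- is where constancy of θ matters.
    · have h3 := sub_mem (sub_projGS_mem hW h𝔴 (S.τ m') θ) (sub_projGS_mem hW h𝔴 (S.τ m) θ)
      rwa [sub_sub_sub_cancel_left] at h3
    · rw [map_sub, sub_sub_cancel, h.genM_mem_C_iff]
      exact (projGS hW h𝔴 (S.τ m') θ).2.1
  have h3 := (hasFDerivAt_comp_extChartAt_symm
    (hx'.mdifferentiableAt (x := m) (by simp))).const_sub (x' (S.τ m))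
  simp only [h2] at h1
  rw [h3.fderiv] at h1
  refine h1.trans ?_
  exact neg_neg _

/-- `i_{ξ_M} Ω_M = d⟨J^nh, ξ⟩ - i_{ξ_M} ⟨𝓙, K_𝓦⟩` on `C`, for `ξ = P_{𝔤_S} (θ)`. -/
theorem IsSymmetry.ΩM_sectionGen {l : ℕ} {e : Fin l → LieAlg EG G}
    (hW : S.IsVerticalComplement EG G W) (h𝔴 : VerticalSymmetry W 𝔴)
    (he : LinearIndependent ℝ e) (hspan : Submodule.span ℝ (Set.range e) = 𝔴) (θ : LieAlg EG G)
    {m : S.M} {Y : S.TM m} (hY : Y ∈ S.C m) :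
    S.ΩM m (h.sectionGen (fun q => projGS hW h𝔴 q θ) m) Y =
      differential 𝓘(ℝ, E × (Fin r → ℝ)) (h.nhMomentum fun q => projGS hW h𝔴 q θ) m Y -
        h.JK 𝔴 m (h.sectionGen (fun q => projGS hW h𝔴 q θ) m) Y := by
  have := h.contMDiffSMul
  have hX : h.sectionGen (fun q => projGS hW h𝔴 q θ) m ∈ S.C m :=
    h.genM_mem_C_iff.2 (projGS hW h𝔴 (S.τ m) θ).2.1
  have h1 := h.modelDeriv_nhMomentum (isSmoothSection_projGS hW h𝔴 he hspan θ) m Y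
  have h2 : h.JK 𝔴 m (h.sectionGen (fun q => projGS hW h𝔴 q θ) m) Y =
      S.momentumM EG G m (extDerivForm 𝓘(ℝ, E × (Fin r → ℝ)) (h.AW 𝔴) m
        (h.projC 𝔴 m (h.sectionGen (fun q => projGS hW h𝔴 q θ) m)) (h.projC 𝔴 m Y)) := rfl
  rw [h.projC_eq hW h𝔴 hX, h.projC_eq hW h𝔴 hY,
    h.extDerivForm_AW hW h𝔴 he hspan θ hY] at h2
  have h3 : differential 𝓘(ℝ, E × (Fin r → ℝ)) (h.nhMomentum fun q => projGS hW h𝔴 q θ) m Y = _ := h1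
  -- The curvature term cancels the derivative of ξ in Leibniz' rule; the momentum identity for the
  -- frozen element remains.
  rw [h2, h3, add_sub_cancel_right]
  exact h.ΩM_genM m _ Y

end NHSystem
end Nonholonomic

/-! ### Linear combinations and the final identity. -/

namespace Nonholonomic
section

variable {E' : Type*} [NormedAddCommGroup E'] [NormedSpace ℝ E']
  {H : Type*} [TopologicalSpace H] {I : ModelWithCorners ℝ E' H} [I.Boundaryless]
  {N : Type*} [TopologicalSpace N] [ChartedSpace H N] [IsManifold I 1 N]

theorem differential_sum_mul {ι : Type} [Fintype ι] {a b : ι → N → ℝ} {x : N}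
    (ha : ∀ i, MDifferentiableAt I 𝓘(ℝ, ℝ) (a i) x) (hb : ∀ i, MDifferentiableAt I 𝓘(ℝ, ℝ) (b i) x)
    (v : TangentSpace I x) :
    differential I (fun x => ∑ i, a i x * b i x) x v =
      ∑ i, (a i x * differential I (b i) x v + b i x * differential I (a i) x v) := by
  have h1 := HasFDerivAt.fun_sum (u := Finset.univ) fun i _ =>
    (hasFDerivAt_comp_extChartAt_symm (ha i)).mul (hasFDerivAt_comp_extChartAt_symm (hb i))
  have h2 : MDifferentiableAt I 𝓘(ℝ, ℝ) (fun x => ∑ i, a i x * b i x) x := by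
    have h : ∀ i ∈ Finset.univ, MDifferentiableAt I 𝓘(ℝ, ℝ) (a i * b i) x :=
      fun i _ => (ha i).mul (hb i)
    have h' : (∑ i, a i * b i) = fun x => ∑ i, a i x * b i x := by
      funext y
      simp
    exact h' ▸ MDifferentiableAt.sum h
  have h3 : ∀ v : E', modelDeriv I 𝓘(ℝ, ℝ) (fun x => ∑ i, a i x * b i x) x v =
      ∑ i, (a i x * modelDeriv I 𝓘(ℝ, ℝ) (b i) x v + b i x * modelDeriv I 𝓘(ℝ, ℝ) (a i) x v) := by
    intro v
    rw [(hasFDerivAt_comp_extChartAt_symm h2).unique h1]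
    simp only [sum_apply, add_apply, smul_apply, smul_eq_mul, extChartAt_to_inv]
  exact h3 v

end
end Nonholonomic

theorem propositionP
    -- the configuration manifold and the nonholonomic system on it
    {E : Type*} [NormedAddCommGroup E] [NormedSpace ℝ E] [FiniteDimensional ℝ E]
    {Q : Type*} [TopologicalSpace Q] [ChartedSpace E Q] [IsManifold 𝓘(ℝ, E) ∞ Q]
    [T2Space Q] [SecondCountableTopology Q]
    {r : ℕ} (S : Nonholonomic.NHSystem E Q r)
    -- the Lie group of symmetries, acting properly
    {EG : Type*} [NormedAddCommGroup EG] [NormedSpace ℝ EG] [FiniteDimensional ℝ EG]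
    {G : Type*} [TopologicalSpace G] [ChartedSpace EG G] [Group G] [LieGroup 𝓘(ℝ, EG) ∞ G]
    [T2Space G]
    [MulAction G Q] [ProperSMul G Q] (hS : S.IsSymmetry EG G)
    -- a vertical complement of the constraints with the vertical-symmetry condition
    (W : ∀ q : Q, Submodule ℝ (TangentSpace 𝓘(ℝ, E) q)) (hW : S.IsVerticalComplement EG G W)
    (𝔴 : Submodule ℝ (Nonholonomic.NHSystem.LieAlg EG G))
    (h𝔴 : Nonholonomic.NHSystem.VerticalSymmetry W 𝔴)
    -- a basis of `𝔤` whose last `l` elements form a basis of `𝔴`, the sections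
    -- `ξ_i = P_{𝔤_S} (η_i)` of `𝔤_S` and the functions `j_i = ⟨J^nh, ξ_i⟩`
    {k l : ℕ} (η : Module.Basis (Fin k ⊕ Fin l) ℝ (Nonholonomic.NHSystem.LieAlg EG G))
    (hη : Submodule.span ℝ (Set.range fun a : Fin l => η (Sum.inr a)) = 𝔴)
    (ξ : Fin k → ∀ q : Q, S.gS EG G q)
    (hξ : ∀ i q, ξ i q = Nonholonomic.NHSystem.projGS hW h𝔴 q (η (Sum.inl i)))
    (j : Fin k → S.M → ℝ) (hj : ∀ i, j i = hS.nhMomentum (ξ i))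
    -- the function `J = Σ f_i j_i` and the section `χ = Σ f_i ξ_i`
    (f : Fin k → Q → ℝ) (hf : ∀ i, ContMDiff 𝓘(ℝ, E) 𝓘(ℝ, ℝ) ∞ (f i))
    (J : S.M → ℝ) (hJ : ∀ m, J m = ∑ i, f i (S.τ m) * j i m)
    (χ : ∀ q : Q, S.gS EG G q) (hχ : ∀ q, χ q = ∑ i, f i q • ξ i q) :
    -- `Ω_M` is nondegenerate on `C`, `TM = C ⊕ 𝓦` and `𝔴 × M ≅ 𝓦`, so that `π_nh^♯`, the projections
    -- and `A_𝓦` are well defined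
    (∀ (m : S.M) (α : S.TM m →ₗ[ℝ] ℝ),
      ∃! X : S.TM m, X ∈ S.C m ∧ ∀ Y ∈ S.C m, S.ΩM m X Y = α Y) ∧
    (∀ m : S.M, IsCompl (S.C m) (hS.WM 𝔴 m) ∧ Function.Injective (hS.genM𝔴 𝔴 m)) ∧
    -- `J` is a smooth function, `χ` is a smooth section and `π_nh^♯ (Λ - dJ) = χ_M`
    ContMDiff 𝓘(ℝ, E × (Fin r → ℝ)) 𝓘(ℝ, ℝ) ∞ J ∧
    Nonholonomic.NHSystem.IsSmoothSection χ ∧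
    ∀ m : S.M, S.piSharp (fun m' => hS.lambdaForm 𝔴 ξ f m' -
      Nonholonomic.differential 𝓘(ℝ, E × (Fin r → ℝ)) J m') m = hS.sectionGen χ m := by
  classical
  have := hS.contMDiffSMul
  have : IsManifold 𝓘(ℝ, E × (Fin r → ℝ)) 1 S.M := IsManifold.of_le (n := ∞) (by simp)
  have he : LinearIndependent ℝ fun a : Fin l => η (Sum.inr a) :=
    η.linearIndependent.comp _ Sum.inr_injective
  have hξ' : ∀ i, ξ i = fun q => Nonholonomic.NHSystem.projGS hW h𝔴 q (η (Sum.inl i)) :=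
    fun i => funext (hξ i)
  have hsm : ∀ i, Nonholonomic.NHSystem.IsSmoothSection (ξ i) := fun i => by
    rw [hξ' i]
    exact Nonholonomic.NHSystem.isSmoothSection_projGS hW h𝔴 he hη _
  have hfτ : ∀ i, ContMDiff 𝓘(ℝ, E × (Fin r → ℝ)) 𝓘(ℝ, ℝ) ∞ fun m : S.M => f i (S.τ m) :=
    fun i => (hf i).comp S.contMDiff_τ
  have hjs : ∀ i, ContMDiff 𝓘(ℝ, E × (Fin r → ℝ)) 𝓘(ℝ, ℝ) ∞ (j i) := fun i => by
    rw [hj i]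
    exact hS.contMDiff_nhMomentum (hsm i)
  obtain rfl : J = fun m => ∑ i, f i (S.τ m) * j i m := funext hJ
  refine ⟨fun m α => S.existsUnique_ΩM m α,
    fun m => ⟨hS.isCompl_C_WM hW h𝔴 m, hS.genM𝔴_injective hW h𝔴 m⟩,
    contMDiff_finsetSum fun i _ => (hfτ i).mul (hjs i), ?_, fun m => ?_⟩
  · have hsum : ContMDiff 𝓘(ℝ, E) 𝓘(ℝ, EG) ∞
        fun q => ∑ i, f i q • Nonholonomic.NHSystem.sectionVal (ξ i) q :=
      contMDiff_finsetSum fun i _ => (hf i).smul (hsm i)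
    refine hsum.congr fun q => ?_
    rw [hχ q]
    exact (map_sum (S.gS EG G q).subtype _ _)
  -- `sectionGen` involves only the value of the section over m, so it is linear over functions on Q
  -- and no derivative of `f` appears here.
  · have hgen : hS.sectionGen χ m = ∑ i, f i (S.τ m) • hS.sectionGen (ξ i) m := by
      change hS.genM m ((S.gS EG G (S.τ m)).subtype (χ (S.τ m))) = _
      rw [hχ, map_sum, map_sum]
      refine Finset.sum_congr rfl fun i _ => ?_
      rw [map_smul, map_smul]
      rfl
    have hC : ∀ i, hS.sectionGen (ξ i) m ∈ S.C m := fun i =>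
      hS.genM_mem_C_iff.2 (ξ i (S.τ m)).2.1
    refine S.piSharp_eq ?_ fun Y hY => ?_
    · rw [hgen]
      exact sum_mem fun i _ => Submodule.smul_mem _ _ (hC i)
    · have hΩ : ∀ i, S.ΩM m (hS.sectionGen (ξ i) m) Y =
          Nonholonomic.differential 𝓘(ℝ, E × (Fin r → ℝ)) (j i) m Y -
            hS.JK 𝔴 m (hS.sectionGen (ξ i) m) Y := fun i => by
        rw [hj i, hξ' i]
        exact hS.ΩM_sectionGen hW h𝔴 he hη _ hY
      have hd := Nonholonomic.differential_sum_mul (I := 𝓘(ℝ, E × (Fin r → ℝ)))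
        (fun i => (hfτ i).mdifferentiableAt (x := m) (by simp))
        (fun i => (hjs i).mdifferentiableAt (x := m) (by simp)) Y
      -- The terms j_i df_i coming from dJ cancel those of Λ, leaving f_i times the identity for
      -- each ξ_i.
      rw [hgen, LinearMap.sub_apply, hd, Nonholonomic.NHSystem.IsSymmetry.lambdaForm]
      simp only [map_sum, map_smul, LinearMap.sum_apply, LinearMap.add_apply,
        LinearMap.smul_apply, hΩ, ← hj, smul_eq_mul]
      rw [← Finset.sum_sub_distrib, ← Finset.sum_neg_distrib]
      exact Finset.sum_congr rfl fun i _ => by ring
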